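/- Let $E=(E^0,E^1,r,s)$ be a finite directed graph with at least one edge which is strongly connected (for all $v,w\in E^0$ there is a finite path from $w$ to $v$). Let $A$ be its vertex matrix, $A(v,w)=|r^{-1}(v)\cap s^{-1}(w)|$, and let $\rho(A)$ be the spectral radius of $A$. Let $C^*(E)$ be the graph algebra of $E$, that is, the $C^*$-algebra generated by a universal family of mutually orthogonal projections $\{p_v:v\in E^0\}$ and partial isometries $\{s_e:e\in E^1\}$ such that $s_e^*s_e=p_{s(e)}$ for $e\in E^1$ and $p_v=\sum_{r(e)=v}s_es_e^*$ for $v\in E^0$; it is unital with unit $\sum_v p_v$. Let $\alpha:\mathbb{R}\to\operatorname{Aut}C^*(E)$ be the dynamics such that $\alpha_t(p_v)=p_v$ and $\alpha_t(s_e)=e^{it}s_e$. For $\beta\in\mathbb{R}$, a KMS$_\beta$ state of $(C^*(E),\alpha)$ is a state $\phi$ such that $\phi(ab)=\phi(b\,\alpha_{i\beta}(a))$ for all $\alpha$-analytic $a,b$ (elements whose orbit $t\mapsto\alpha_t(a)$ extends to an entire function $z\mapsto\alpha_z(a)$); for $\beta=0$ one also requires, as usual, that $\phi$ is $\alpha$-invariant.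 Then $\rho(A)>0$ and: 1. $(C^*(E),\alpha)$ has at most one KMS state: if $\phi_1$ is a KMS$_{\beta_1}$ state and $\phi_2$ is a KMS$_{\beta_2}$ state, then $\phi_1=\phi_2$; 2. every KMS$_\beta$ state of $(C^*(E),\alpha)$ has inverse temperature $\beta=\ln\rho(A)$; 3. $(C^*(E),\alpha)$ has a KMS$_{\ln\rho(A)}$ state. -/

import Mathlib

open scoped ComplexOrder

noncomputable section

/-! ## Directed graphs -/

/-- A directed graph with vertex set `V`, edge set `E`, range map `rng` and source map `src`
(loops and parallel edges are allowed). -/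
structure DirGraph (V : Type*) (E : Type*) where
  /-- the range of an edge -/
  rng : E → V
  /-- the source of an edge -/
  src : E → V

namespace DirGraph

/-- There is a finite path (possibly of length zero) from `w` to `v`. -/
def HasPath {V E : Type*} (G : DirGraph V E) (v w : V) : Prop :=
  Relation.ReflTransGen (fun a b => ∃ e, G.rng e = a ∧ G.src e = b) v w

/-- A graph is strongly connected if any two vertices are joined by a path, in both directions. -/
def IsStronglyConnected {V E : Type*} (G : DirGraph V E) : Prop :=
  ∀ v w, G.HasPath v w

/-- The vertex matrix: the entry at `(v, w)` is the number of edges with range `v`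
and source `w`. -/
def vertexMatrix {V E : Type*} (G : DirGraph V E) : Matrix V V ℤ :=
  Matrix.of fun v w => (Nat.card {e : E // G.rng e = v ∧ G.src e = w} : ℤ)

open Classical in
/-- The spectral radius of the vertex matrix, that is, the largest modulus of a complex
eigenvalue. -/
def rho {V E : Type*} [Fintype V] (G : DirGraph V E) : ℝ :=
  (spectralRadius ℂ (G.vertexMatrix.map (fun n : ℤ => (n : ℂ)))).toReal

open Classical in
/-- A Cuntz-Krieger family of a finite graph in a unital star algebra whose unit is the sum of the
vertex projections: the `P v` are mutually orthogonal projections with sum `1`,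
`S e ^* S e = P (src e)`, and `P v` is the sum of the `S e S e ^*` over the edges `e` with range
`v`. In a C*-algebra the `S e` are then automatically partial isometries. (Any Cuntz-Krieger
family in any C*-algebra is of this kind in the corner cut out by the projection `∑ v, P v`.) -/
structure IsCuntzKriegerFamily {V E : Type*} [Fintype V] [Fintype E] (G : DirGraph V E)
    {A : Type*} [Ring A] [StarRing A] (P : V → A) (S : E → A) : Prop where
  star_P : ∀ v, star (P v) = P v
  P_mul_P_self : ∀ v, P v * P v = P v
  P_mul_P : ∀ v w, v ≠ w → P v * P w = 0
  sum_P : ∑ v, P v = 1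
  star_S_mul_S : ∀ e, star (S e) * S e = P (G.src e)
  P_eq_sum : ∀ v, P v = ∑ e with G.rng e = v, S e * star (S e)

end DirGraph

/-! ## The free unital complex star algebra -/

/-- Formal generators `x` (left summand) and formal adjoints `x^*` (right summand). -/
abbrev StarLetter (X : Type*) : Type _ := X ⊕ X

/-- The free unital complex star algebra on the set `X`: noncommutative polynomials in the
letters `x` and `x^*`. -/
abbrev FreeStarAlg (X : Type*) : Type _ := MonoidAlgebra ℂ (FreeMonoid (StarLetter X))

namespace FreeStarAlg

variable {X : Type*}

/-- A letter as an element of the free star algebra. -/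
def letter (x : StarLetter X) : FreeStarAlg X :=
  MonoidAlgebra.of ℂ (FreeMonoid (StarLetter X)) (FreeMonoid.of x)

/-- The generators of the free star algebra. -/
def gen (x : X) : FreeStarAlg X := letter (Sum.inl x)

theorem induction {motive : FreeStarAlg X → Prop}
    (scalar : ∀ c : ℂ, motive (algebraMap ℂ _ c)) (letter : ∀ x, motive (letter x))
    (add : ∀ a b, motive a → motive b → motive (a + b))
    (mul : ∀ a b, motive a → motive b → motive (a * b)) (a : FreeStarAlg X) : motive a := by
  have hw : ∀ w : FreeMonoid (StarLetter X),
      motive (MonoidAlgebra.of ℂ (FreeMonoid (StarLetter X)) w) := by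
    intro w
    induction w using FreeMonoid.inductionOn' with
    | one => simpa using! scalar 1
    | of_mul x w ih => rw [map_mul]; exact mul _ _ (letter x) ih
  refine MonoidAlgebra.induction_on (motive := motive) a hw add ?_
  intro c f hf
  have := mul _ _ (scalar c) hf
  rwa [← Algebra.smul_def] at this

/-- The conjugate-linear ring homomorphism out of the free star algebra with prescribed values on
letters. -/
def conjLift {R : Type*} [Ring R] [Algebra ℂ R] (g : StarLetter X → R) : FreeStarAlg X →+* R :=
  MonoidAlgebra.liftNCRingHom ((algebraMap ℂ R).comp (starRingEnd ℂ)) (FreeMonoid.lift g)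
    (fun _ _ => Algebra.commute_algebraMap_left _ _)

theorem conjLift_algebraMap {R : Type*} [Ring R] [Algebra ℂ R] (g : StarLetter X → R) (c : ℂ) :
    conjLift g (algebraMap ℂ (FreeStarAlg X) c) = algebraMap ℂ R (star c) := by
  simp [conjLift, MonoidAlgebra.liftNCRingHom]

theorem conjLift_letter {R : Type*} [Ring R] [Algebra ℂ R] (g : StarLetter X → R)
    (x : StarLetter X) : conjLift g (letter x) = g x := by
  simp [conjLift, MonoidAlgebra.liftNCRingHom, letter]

/-- The involution as a ring homomorphism to the opposite ring: it conjugates scalars, reverses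
words, and exchanges `x` and `x^*`. -/
def starHom : FreeStarAlg X →+* (FreeStarAlg X)ᵐᵒᵖ :=
  conjLift fun x => MulOpposite.op (letter x.swap)

theorem starHom_algebraMap (c : ℂ) :
    starHom (algebraMap ℂ (FreeStarAlg X) c) =
      MulOpposite.op (algebraMap ℂ (FreeStarAlg X) (star c)) :=
  conjLift_algebraMap _ c

theorem starHom_letter (x : StarLetter X) :
    starHom (letter x) = MulOpposite.op (letter x.swap) :=
  conjLift_letter _ x

instance : StarRing (FreeStarAlg X) where
  star a := (starHom a).unop
  star_involutive a := by
    induction a using induction with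
    | scalar c => simp only [starHom_algebraMap, MulOpposite.unop_op, star_star]
    | letter x => simp [starHom_letter]
    | add a b ha hb => simp only [map_add, MulOpposite.unop_add, ha, hb]
    | mul a b ha hb => simp only [map_mul, MulOpposite.unop_mul, ha, hb]
  star_mul a b := by simp
  star_add a b := by simp

theorem star_algebraMap (c : ℂ) :
    star (algebraMap ℂ (FreeStarAlg X) c) = algebraMap ℂ (FreeStarAlg X) (star c) :=
  congrArg MulOpposite.unop (starHom_algebraMap c)

theorem star_letter (x : StarLetter X) : star (letter x) = letter x.swap :=
  congrArg MulOpposite.unop (starHom_letter x)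

instance : StarModule ℂ (FreeStarAlg X) where
  star_smul c a := by
    rw [Algebra.smul_def, star_mul, star_algebraMap, ← Algebra.commutes, ← Algebra.smul_def]

/-- Evaluation of noncommutative star polynomials in a complex star algebra. -/
def eval {A : Type*} [Ring A] [StarRing A] [Algebra ℂ A] [StarModule ℂ A] (f : X → A) :
    FreeStarAlg X →⋆ₐ[ℂ] A :=
  let φ : FreeStarAlg X →ₐ[ℂ] A :=
    MonoidAlgebra.lift ℂ A (FreeMonoid (StarLetter X))
      (FreeMonoid.lift (Sum.elim f fun x => star (f x)))
  have hφ : ∀ x, φ (letter x) = Sum.elim f (fun x => star (f x)) x := fun x => by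
    simp only [φ, letter]
    erw [MonoidAlgebra.lift_of]
    simp
  { φ with
    map_star' := fun a => by
      change φ (star a) = star (φ a)
      induction a using induction with
      | scalar c => rw [star_algebraMap, AlgHom.commutes, AlgHom.commutes, algebraMap_star_comm]
      | letter x => rw [star_letter, hφ, hφ]; cases x <;> simp
      | add a b ha hb => rw [star_add, map_add, map_add, star_add, ha, hb]
      | mul a b ha hb => rw [star_mul, map_mul, map_mul, star_mul, ha, hb] }

theorem eval_gen {A : Type*} [Ring A] [StarRing A] [Algebra ℂ A] [StarModule ℂ A] (f : X → A)
    (x : X) : eval f (gen x) = f x := by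
  change MonoidAlgebra.lift ℂ A (FreeMonoid (StarLetter X))
      (FreeMonoid.lift (Sum.elim f fun x => star (f x))) (MonoidAlgebra.of _ _ _) = f x
  rw [MonoidAlgebra.lift_of]
  simp

end FreeStarAlg

/-! ## The graph C*-algebra -/

namespace DirGraph

variable {V E : Type*} [Fintype V] [Fintype E] (G : DirGraph V E)

open Classical in
/-- The Cuntz-Krieger relations, imposed on the free star algebra on the symbols `p v`, `s e`. -/
inductive CKRel : FreeStarAlg (V ⊕ E) → FreeStarAlg (V ⊕ E) → Prop
  | star_p (v : V) :
      CKRel (star (FreeStarAlg.gen (Sum.inl v))) (FreeStarAlg.gen (Sum.inl v))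
  | p_mul_p_self (v : V) :
      CKRel (FreeStarAlg.gen (Sum.inl v) * FreeStarAlg.gen (Sum.inl v))
        (FreeStarAlg.gen (Sum.inl v))
  | p_mul_p (v w : V) (h : v ≠ w) :
      CKRel (FreeStarAlg.gen (Sum.inl v) * FreeStarAlg.gen (Sum.inl w)) 0
  | sum_p : CKRel (∑ v : V, FreeStarAlg.gen (Sum.inl v)) 1
  | star_s_mul_s (e : E) :
      CKRel (star (FreeStarAlg.gen (Sum.inr e)) * FreeStarAlg.gen (Sum.inr e))
        (FreeStarAlg.gen (Sum.inl (G.src e)))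
  | p_eq_sum (v : V) :
      CKRel (FreeStarAlg.gen (Sum.inl v))
        (∑ e with G.rng e = v,
          FreeStarAlg.gen (Sum.inr e) * star (FreeStarAlg.gen (Sum.inr e)))

/-- A C*-seminorm on the free star algebra on the symbols `p v`, `s e` which respects the
Cuntz-Krieger relations. -/
structure CKSeminorm extends Seminorm ℂ (FreeStarAlg (V ⊕ E)) where
  mul_le' : ∀ a b, toFun (a * b) ≤ toFun a * toFun b
  sq_le' : ∀ a, toFun a * toFun a ≤ toFun (star a * a)
  rel' : ∀ a b, G.CKRel a b → toFun (a - b) = 0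

namespace CKSeminorm

variable {G}

instance : Inhabited G.CKSeminorm :=
  ⟨{ (0 : Seminorm ℂ (FreeStarAlg (V ⊕ E))) with
      mul_le' := fun _ _ => (zero_mul (0 : ℝ)).ge
      sq_le' := fun _ => (zero_mul (0 : ℝ)).le
      rel' := fun _ _ _ => rfl }⟩

variable (N : G.CKSeminorm)

theorem mul_le (a b : FreeStarAlg (V ⊕ E)) :
    N.toSeminorm (a * b) ≤ N.toSeminorm a * N.toSeminorm b := N.mul_le' a b

theorem sq_le (a : FreeStarAlg (V ⊕ E)) :
    N.toSeminorm a * N.toSeminorm a ≤ N.toSeminorm (star a * a) := N.sq_le' a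

theorem star_le (a : FreeStarAlg (V ⊕ E)) : N.toSeminorm (star a) ≤ N.toSeminorm a := by
  rcases (apply_nonneg N.toSeminorm (star a)).eq_or_lt with h | h
  · rw [← h]; exact apply_nonneg _ _
  · have h1 := N.sq_le (star a)
    rw [star_star] at h1
    have h2 := N.mul_le a (star a)
    exact le_of_mul_le_mul_right (h1.trans h2) h

theorem eq_of_rel {a b : FreeStarAlg (V ⊕ E)} (h : G.CKRel a b) :
    N.toSeminorm a = N.toSeminorm b := by
  have h0 : N.toSeminorm (a - b) = 0 := N.rel' a b h
  have h1 := map_sub_le_add N.toSeminorm a (a - b)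
  have h2 : N.toSeminorm a ≤ N.toSeminorm b + N.toSeminorm (a - b) := by
    simpa using map_add_le_add N.toSeminorm b (a - b)
  rw [sub_sub_cancel] at h1
  linarith

theorem le_one_of_sq {x : ℝ} (h : x * x ≤ x) : x ≤ 1 := by nlinarith

theorem one_le : N.toSeminorm 1 ≤ 1 :=
  le_one_of_sq (by simpa using N.sq_le 1)

theorem p_le (v : V) : N.toSeminorm (FreeStarAlg.gen (Sum.inl v)) ≤ 1 := by
  refine le_one_of_sq ((N.sq_le _).trans ?_)
  have h1 : N.toSeminorm (star (FreeStarAlg.gen (Sum.inl v)) * FreeStarAlg.gen (Sum.inl v)) ≤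
      N.toSeminorm ((star (FreeStarAlg.gen (Sum.inl v)) - FreeStarAlg.gen (Sum.inl v)) *
        FreeStarAlg.gen (Sum.inl v)) +
      N.toSeminorm (FreeStarAlg.gen (Sum.inl v) * FreeStarAlg.gen (Sum.inl v)) := by
    refine le_trans (le_of_eq (congrArg _ ?_)) (map_add_le_add N.toSeminorm _ _)
    rw [sub_mul, sub_add_cancel]
  have h2 := N.mul_le (star (FreeStarAlg.gen (Sum.inl v)) - FreeStarAlg.gen (Sum.inl v))
    (FreeStarAlg.gen (Sum.inl v))
  have h3 : N.toSeminorm (star (FreeStarAlg.gen (Sum.inl v)) - FreeStarAlg.gen (Sum.inl v)) = 0 :=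
    N.rel' _ _ (CKRel.star_p v)
  have h4 := N.eq_of_rel (CKRel.p_mul_p_self v)
  rw [h3, zero_mul] at h2
  linarith

theorem s_le (e : E) : N.toSeminorm (FreeStarAlg.gen (Sum.inr e)) ≤ 1 := by
  have h1 := N.sq_le (FreeStarAlg.gen (Sum.inr e))
  rw [N.eq_of_rel (CKRel.star_s_mul_s e)] at h1
  have h2 := N.p_le (G.src e)
  nlinarith

theorem letter_le (x : StarLetter (V ⊕ E)) : N.toSeminorm (FreeStarAlg.letter x) ≤ 1 := by
  rcases x with (v | e) | (v | e)
  · exact N.p_le v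
  · exact N.s_le e
  · have := (N.star_le (FreeStarAlg.gen (Sum.inl v))).trans (N.p_le v)
    rwa [FreeStarAlg.gen, FreeStarAlg.star_letter] at this
  · have := (N.star_le (FreeStarAlg.gen (Sum.inr e))).trans (N.s_le e)
    rwa [FreeStarAlg.gen, FreeStarAlg.star_letter] at this

variable (G) in
theorem exists_bound (a : FreeStarAlg (V ⊕ E)) :
    ∃ C, ∀ N : G.CKSeminorm, N.toSeminorm a ≤ C := by
  induction a using FreeStarAlg.induction with
  | scalar c =>
    refine ⟨‖c‖, fun N => ?_⟩
    rw [Algebra.algebraMap_eq_smul_one, map_smul_eq_mul]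
    exact mul_le_of_le_one_right (norm_nonneg c) N.one_le
  | letter x => exact ⟨1, fun N => N.letter_le x⟩
  | add a b ha hb =>
    obtain ⟨C, hC⟩ := ha
    obtain ⟨D, hD⟩ := hb
    exact ⟨C + D, fun N => (map_add_le_add _ _ _).trans (add_le_add (hC N) (hD N))⟩
  | mul a b ha hb =>
    obtain ⟨C, hC⟩ := ha
    obtain ⟨D, hD⟩ := hb
    exact ⟨C * D, fun N => (N.mul_le a b).trans
      (mul_le_mul (hC N) (hD N) (apply_nonneg _ _) ((apply_nonneg _ _).trans (hC N)))⟩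

variable (G) in
theorem bddAbove (a : FreeStarAlg (V ⊕ E)) :
    BddAbove (Set.range fun N : G.CKSeminorm => N.toSeminorm a) := by
  obtain ⟨C, hC⟩ := exists_bound G a
  exact ⟨C, by rintro _ ⟨N, rfl⟩; exact hC N⟩

end CKSeminorm

/-- The largest C*-seminorm respecting the Cuntz-Krieger relations. -/
def maxNorm (a : FreeStarAlg (V ⊕ E)) : ℝ := ⨆ N : G.CKSeminorm, N.toSeminorm a

theorem le_maxNorm (N : G.CKSeminorm) (a : FreeStarAlg (V ⊕ E)) : N.toSeminorm a ≤ G.maxNorm a :=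
  le_ciSup (CKSeminorm.bddAbove G a) N

theorem maxNorm_nonneg (a : FreeStarAlg (V ⊕ E)) : 0 ≤ G.maxNorm a :=
  (apply_nonneg _ _).trans (G.le_maxNorm default a)

theorem maxNorm_add_le (a b : FreeStarAlg (V ⊕ E)) :
    G.maxNorm (a + b) ≤ G.maxNorm a + G.maxNorm b :=
  ciSup_le fun N => (map_add_le_add _ _ _).trans (add_le_add (G.le_maxNorm N a) (G.le_maxNorm N b))

theorem maxNorm_mul_le (a b : FreeStarAlg (V ⊕ E)) :
    G.maxNorm (a * b) ≤ G.maxNorm a * G.maxNorm b :=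
  ciSup_le fun N => (N.mul_le a b).trans
    (mul_le_mul (G.le_maxNorm N a) (G.le_maxNorm N b) (apply_nonneg _ _) (G.maxNorm_nonneg a))

theorem maxNorm_smul_le (c : ℂ) (a : FreeStarAlg (V ⊕ E)) :
    G.maxNorm (c • a) ≤ ‖c‖ * G.maxNorm a :=
  ciSup_le fun N => by
    rw [map_smul_eq_mul]
    exact mul_le_mul_of_nonneg_left (G.le_maxNorm N a) (norm_nonneg c)

theorem maxNorm_sq_le (a : FreeStarAlg (V ⊕ E)) :
    G.maxNorm a * G.maxNorm a ≤ G.maxNorm (star a * a) := by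
  have h : ∀ N : G.CKSeminorm, N.toSeminorm a ≤ Real.sqrt (G.maxNorm (star a * a)) := fun N =>
    Real.le_sqrt_of_sq_le (by rw [sq]; exact (N.sq_le a).trans (G.le_maxNorm N _))
  calc G.maxNorm a * G.maxNorm a
      ≤ Real.sqrt (G.maxNorm (star a * a)) * Real.sqrt (G.maxNorm (star a * a)) :=
        mul_self_le_mul_self (G.maxNorm_nonneg a) (ciSup_le h)
    _ = G.maxNorm (star a * a) := Real.mul_self_sqrt (G.maxNorm_nonneg _)

theorem maxNorm_star_le (a : FreeStarAlg (V ⊕ E)) : G.maxNorm (star a) ≤ G.maxNorm a :=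
  ciSup_le fun N => (N.star_le a).trans (G.le_maxNorm N a)

theorem maxNorm_rel {a b : FreeStarAlg (V ⊕ E)} (h : G.CKRel a b) : G.maxNorm (a - b) = 0 :=
  le_antisymm (ciSup_le fun N => (N.rel' a b h).le) (G.maxNorm_nonneg _)

/-- The free star algebra on the symbols `p v`, `s e`, endowed with the largest C*-seminorm
respecting the Cuntz-Krieger relations. -/
def PreAlg {V E : Type*} (_G : DirGraph V E) : Type _ := FreeStarAlg (V ⊕ E)

instance : Ring G.PreAlg := inferInstanceAs (Ring (FreeStarAlg (V ⊕ E)))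
instance : StarRing G.PreAlg := inferInstanceAs (StarRing (FreeStarAlg (V ⊕ E)))
instance : Algebra ℂ G.PreAlg := inferInstanceAs (Algebra ℂ (FreeStarAlg (V ⊕ E)))
instance : StarModule ℂ G.PreAlg := inferInstanceAs (StarModule ℂ (FreeStarAlg (V ⊕ E)))

instance : SeminormedAddCommGroup G.PreAlg :=
  AddGroupSeminorm.toSeminormedAddCommGroup
    { toFun := G.maxNorm
      map_zero' := by
        have h := G.maxNorm_smul_le 0 0
        rw [smul_zero, norm_zero, zero_mul] at h
        exact le_antisymm h (G.maxNorm_nonneg 0)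
      add_le' := G.maxNorm_add_le
      neg' := fun a => by
        have h : ∀ a, G.maxNorm (-a) ≤ G.maxNorm a := fun a => by
          simpa using G.maxNorm_smul_le (-1) a
        exact le_antisymm (h a) ((congrArg G.maxNorm (neg_neg a)).ge.trans (h (-a))) }

instance : SeminormedRing G.PreAlg :=
  { (inferInstance : Ring G.PreAlg), (inferInstance : SeminormedAddCommGroup G.PreAlg) with
    norm_mul_le := G.maxNorm_mul_le }

instance : NormedSpace ℂ G.PreAlg where
  norm_smul_le := G.maxNorm_smul_le

instance : NormedStarGroup G.PreAlg where
  norm_star_le := G.maxNorm_star_le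

theorem PreAlg.norm_def (a : G.PreAlg) : ‖a‖ = G.maxNorm a := rfl

/-- The graph C*-algebra `C*(G)`: the Hausdorff completion of the free star algebra on the symbols
`p v`, `s e` in the largest C*-seminorm respecting the Cuntz-Krieger relations. Its universal
property among C*-algebras generated by Cuntz-Krieger families is proved below. -/
def CStar : Type _ := UniformSpace.Completion G.PreAlg

namespace CStar

variable {G}

instance : NormedRing G.CStar := inferInstanceAs (NormedRing (UniformSpace.Completion G.PreAlg))
instance : CompleteSpace G.CStar :=
  inferInstanceAs (CompleteSpace (UniformSpace.Completion G.PreAlg))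
instance : Algebra ℂ G.CStar := inferInstanceAs (Algebra ℂ (UniformSpace.Completion G.PreAlg))

/-- The canonical map from star polynomials to the graph C*-algebra. -/
def mk : FreeStarAlg (V ⊕ E) →ₐ[ℂ] G.CStar :=
  { (UniformSpace.Completion.coeRingHom : G.PreAlg →+* UniformSpace.Completion G.PreAlg) with
    commutes' := fun _ => rfl }

theorem norm_mk (a : FreeStarAlg (V ⊕ E)) : ‖(mk a : G.CStar)‖ = G.maxNorm a :=
  UniformSpace.Completion.norm_coe (E := G.PreAlg) a

theorem denseRange_mk : DenseRange (mk : FreeStarAlg (V ⊕ E) → G.CStar) :=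
  UniformSpace.Completion.denseRange_coe (α := G.PreAlg)

instance : NormedAlgebra ℂ G.CStar where
  norm_smul_le c a := by
    induction a using DenseRange.induction_on (denseRange_mk (G := G)) with
    | hp => exact isClosed_le (by simp only [Algebra.smul_def]; fun_prop) (by fun_prop)
    | ih a =>
      rw [← map_smul, norm_mk, norm_mk]
      exact G.maxNorm_smul_le c a

instance : Star G.CStar := ⟨UniformSpace.Completion.map star⟩

theorem continuous_star' : Continuous (star : G.CStar → G.CStar) :=
  UniformSpace.Completion.continuous_map

theorem star_mk (a : FreeStarAlg (V ⊕ E)) : star (mk a : G.CStar) = mk (star a) :=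
  UniformSpace.Completion.map_coe (star_isometry (E := G.PreAlg)).uniformContinuous a

instance : StarRing G.CStar where
  star_involutive a := by
    induction a using DenseRange.induction_on (denseRange_mk (G := G)) with
    | hp => exact isClosed_eq (continuous_star'.comp continuous_star') continuous_id
    | ih a => rw [star_mk, star_mk, star_star]
  star_mul a b := by
    induction a, b using DenseRange.induction_on₂ (denseRange_mk (G := G)) with
    | hp =>
      exact isClosed_eq (continuous_star'.comp (by fun_prop))
        ((continuous_star'.comp continuous_snd).mul (continuous_star'.comp continuous_fst))
    | h a b => rw [← map_mul, star_mk, star_mk, star_mk, star_mul, map_mul]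
  star_add a b := by
    induction a, b using DenseRange.induction_on₂ (denseRange_mk (G := G)) with
    | hp =>
      exact isClosed_eq (continuous_star'.comp (by fun_prop))
        ((continuous_star'.comp continuous_fst).add (continuous_star'.comp continuous_snd))
    | h a b => rw [← map_add, star_mk, star_mk, star_mk, star_add, map_add]

instance : CStarRing G.CStar where
  norm_mul_self_le a := by
    induction a using DenseRange.induction_on (denseRange_mk (G := G)) with
    | hp =>
      exact isClosed_le (by fun_prop) ((continuous_star'.mul continuous_id).norm)
    | ih a =>
      rw [star_mk, ← map_mul, norm_mk, norm_mk]
      exact G.maxNorm_sq_le a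

instance : StarModule ℂ G.CStar where
  star_smul c a := by
    induction a using DenseRange.induction_on (denseRange_mk (G := G)) with
    | hp =>
      exact isClosed_eq (continuous_star'.comp (continuous_const_smul c))
        (continuous_star'.const_smul (star c))
    | ih a => rw [← map_smul, star_mk, star_mk, star_smul, map_smul]

instance : CStarAlgebra G.CStar where

variable (G) in
/-- The vertex projections of the graph C*-algebra. -/
def p (v : V) : G.CStar := mk (FreeStarAlg.gen (Sum.inl v))

variable (G) in
/-- The edge partial isometries of the graph C*-algebra. -/
def s (e : E) : G.CStar := mk (FreeStarAlg.gen (Sum.inr e))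

theorem mk_eq_of_rel {a b : FreeStarAlg (V ⊕ E)} (h : G.CKRel a b) :
    (mk a : G.CStar) = mk b := by
  rw [← sub_eq_zero, ← map_sub, ← norm_eq_zero, norm_mk]
  exact G.maxNorm_rel h

theorem isCuntzKriegerFamily : G.IsCuntzKriegerFamily (p G) (s G) where
  star_P v := (star_mk _).trans (mk_eq_of_rel (.star_p v))
  P_mul_P_self v := (map_mul mk _ _).symm.trans (mk_eq_of_rel (.p_mul_p_self v))
  P_mul_P v w h :=
    ((map_mul mk _ _).symm.trans (mk_eq_of_rel (.p_mul_p v w h))).trans (map_zero mk)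
  sum_P := ((map_sum mk _ _).symm.trans (mk_eq_of_rel .sum_p)).trans (map_one mk)
  star_S_mul_S e := by
    rw [s, star_mk]
    exact (map_mul mk _ _).symm.trans (mk_eq_of_rel (.star_s_mul_s e))
  P_eq_sum v := by
    refine (mk_eq_of_rel (.p_eq_sum v)).trans ((map_sum mk _ _).trans ?_)
    refine Finset.sum_congr rfl fun e _ => ?_
    rw [s, star_mk]
    exact map_mul mk _ _

/-- The seminorm induced by a Cuntz-Krieger family in a C*-algebra. -/
def seminormOf {A : Type*} [CStarAlgebra A] {P : V → A} {S : E → A}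
    (h : G.IsCuntzKriegerFamily P S) : G.CKSeminorm :=
  { (normSeminorm ℂ A).comp (FreeStarAlg.eval (Sum.elim P S)).toAlgHom.toLinearMap with
    mul_le' := fun a b => by
      change ‖FreeStarAlg.eval (Sum.elim P S) (a * b)‖ ≤
        ‖FreeStarAlg.eval (Sum.elim P S) a‖ * ‖FreeStarAlg.eval (Sum.elim P S) b‖
      rw [map_mul]
      exact norm_mul_le _ _
    sq_le' := fun a => by
      change ‖FreeStarAlg.eval (Sum.elim P S) a‖ * ‖FreeStarAlg.eval (Sum.elim P S) a‖ ≤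
        ‖FreeStarAlg.eval (Sum.elim P S) (star a * a)‖
      rw [map_mul, map_star]
      exact CStarRing.norm_star_mul_self.ge
    rel' := fun a b hab => by
      change ‖FreeStarAlg.eval (Sum.elim P S) (a - b)‖ = 0
      rw [map_sub, norm_eq_zero, sub_eq_zero]
      cases hab with
      | star_p v => rw [map_star, FreeStarAlg.eval_gen]; exact h.star_P v
      | p_mul_p_self v => rw [map_mul, FreeStarAlg.eval_gen]; exact h.P_mul_P_self v
      | p_mul_p v w hvw =>
        rw [map_mul, FreeStarAlg.eval_gen, FreeStarAlg.eval_gen, map_zero]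
        exact h.P_mul_P v w hvw
      | sum_p => simp only [map_sum, FreeStarAlg.eval_gen, map_one]; exact h.sum_P
      | star_s_mul_s e =>
        rw [map_mul, map_star, FreeStarAlg.eval_gen, FreeStarAlg.eval_gen]
        exact h.star_S_mul_S e
      | p_eq_sum v =>
        simp only [map_sum, map_mul, map_star, FreeStarAlg.eval_gen]
        exact h.P_eq_sum v }

/-- Evaluation at a Cuntz-Krieger family, as a ring homomorphism on seminormed star
polynomials. -/
def preLift {A : Type*} [CStarAlgebra A] (P : V → A) (S : E → A) : G.PreAlg →+* A :=
  ((FreeStarAlg.eval (Sum.elim P S)).toAlgHom.toRingHom : FreeStarAlg (V ⊕ E) →+* A)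

theorem continuous_preLift {A : Type*} [CStarAlgebra A] {P : V → A} {S : E → A}
    (h : G.IsCuntzKriegerFamily P S) : Continuous (preLift P S : G.PreAlg →+* A) :=
  AddMonoidHomClass.continuous_of_bound (preLift P S : G.PreAlg →+* A) 1 fun a => by
    rw [one_mul]
    exact G.le_maxNorm (seminormOf h) a

/-- The universal property of the graph C*-algebra: a Cuntz-Krieger family `(P, S)` in a
C*-algebra induces a star homomorphism with `p v ↦ P v` and `s e ↦ S e`. -/
def lift {A : Type*} [CStarAlgebra A] {P : V → A} {S : E → A}
    (h : G.IsCuntzKriegerFamily P S) : G.CStar →⋆ₐ[ℂ] A :=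
  let φ : G.CStar →+* A :=
    (UniformSpace.Completion.extensionHom (preLift P S : G.PreAlg →+* A) (continuous_preLift h) :
      UniformSpace.Completion G.PreAlg →+* A)
  have hc : Continuous φ :=
    UniformSpace.Completion.continuous_extension (f := (preLift P S : G.PreAlg →+* A))
  have hφ : ∀ a : FreeStarAlg (V ⊕ E), φ (mk a) = FreeStarAlg.eval (Sum.elim P S) a := fun a =>
    UniformSpace.Completion.extensionHom_coe (preLift P S : G.PreAlg →+* A)
      (continuous_preLift h) a
  { φ with
    commutes' := fun c => by
      have h1 : algebraMap ℂ G.CStar c = mk (algebraMap ℂ _ c) := rfl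
      change φ _ = _
      rw [h1, hφ]
      exact AlgHomClass.commutes _ c
    map_star' := fun a => by
      change φ (star a) = star (φ a)
      induction a using DenseRange.induction_on (denseRange_mk (G := G)) with
      | hp => exact isClosed_eq (hc.comp continuous_star') hc.star
      | ih a => rw [star_mk, hφ, hφ, map_star] }

theorem lift_mk {A : Type*} [CStarAlgebra A] {P : V → A} {S : E → A}
    (h : G.IsCuntzKriegerFamily P S) (a : FreeStarAlg (V ⊕ E)) :
    lift h (mk a) = FreeStarAlg.eval (Sum.elim P S) a :=
  UniformSpace.Completion.extensionHom_coe (preLift P S : G.PreAlg →+* A)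
    (continuous_preLift h) a

@[simp] theorem lift_p {A : Type*} [CStarAlgebra A] {P : V → A} {S : E → A}
    (h : G.IsCuntzKriegerFamily P S) (v : V) : lift h (p G v) = P v :=
  (lift_mk h _).trans (FreeStarAlg.eval_gen _ _)

@[simp] theorem lift_s {A : Type*} [CStarAlgebra A] {P : V → A} {S : E → A}
    (h : G.IsCuntzKriegerFamily P S) (e : E) : lift h (s G e) = S e :=
  (lift_mk h _).trans (FreeStarAlg.eval_gen _ _)

/-- The graph C*-algebra is generated by `p` and `s`: star homomorphisms are determined by their
values on these elements. -/
theorem hom_ext {A : Type*} [CStarAlgebra A] {φ ψ : G.CStar →⋆ₐ[ℂ] A}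
    (hp : ∀ v, φ (p G v) = ψ (p G v)) (hs : ∀ e, φ (s G e) = ψ (s G e)) : φ = ψ := by
  have hcont : ∀ χ : G.CStar →⋆ₐ[ℂ] A, Continuous χ := fun χ =>
    AddMonoidHomClass.continuous_of_bound χ 1 fun a => by
      rw [one_mul]; exact NonUnitalStarAlgHom.norm_apply_le χ a
  have key : ∀ a : FreeStarAlg (V ⊕ E), φ (mk a) = ψ (mk a) := by
    intro a
    induction a using FreeStarAlg.induction with
    | scalar c =>
      have hc : (mk (algebraMap ℂ _ c) : G.CStar) = algebraMap ℂ _ c :=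
        AlgHomClass.commutes mk c
      rw [hc, AlgHomClass.commutes, AlgHomClass.commutes]
    | letter x =>
      have hst : ∀ y : V ⊕ E, (mk (FreeStarAlg.letter (Sum.inr y)) : G.CStar)
          = star (mk (FreeStarAlg.gen y)) := fun y => by
        rw [star_mk, FreeStarAlg.gen, FreeStarAlg.star_letter, Sum.swap_inl]
      rcases x with (v | e) | (v | e)
      · exact hp v
      · exact hs e
      · rw [hst, map_star, map_star]; exact congrArg star (hp v)
      · rw [hst, map_star, map_star]; exact congrArg star (hs e)
    | add a b ha hb => rw [map_add, map_add, map_add, ha, hb]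
    | mul a b ha hb => rw [map_mul, map_mul, map_mul, ha, hb]
  exact DFunLike.coe_injective (denseRange_mk.equalizer (hcont φ) (hcont ψ) (funext key))

/-! ### The gauge action and the dynamics -/

theorem isCuntzKriegerFamily_gauge (z : Circle) :
    G.IsCuntzKriegerFamily (p G) (fun e => (z : ℂ) • s G e) := by
  have hz : star (z : ℂ) * (z : ℂ) = 1 := by
    have := Circle.normSq_coe z
    rw [Complex.star_def, ← Complex.normSq_eq_conj_mul_self, this, Complex.ofReal_one]
  have hz' : (z : ℂ) * star (z : ℂ) = 1 := by rw [mul_comm, hz]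
  have h := isCuntzKriegerFamily (G := G)
  exact
    { star_P := h.star_P
      P_mul_P_self := h.P_mul_P_self
      P_mul_P := h.P_mul_P
      sum_P := h.sum_P
      star_S_mul_S := fun e => by
        rw [star_smul, smul_mul_smul_comm, hz, one_smul, h.star_S_mul_S]
      P_eq_sum := fun v => by
        rw [h.P_eq_sum v]
        refine Finset.sum_congr rfl fun e _ => ?_
        rw [star_smul, smul_mul_smul_comm, hz', one_smul] }

variable (G) in
/-- The endomorphism with `p v ↦ p v` and `s e ↦ z s e`. -/
def gaugeHom (z : Circle) : G.CStar →⋆ₐ[ℂ] G.CStar := lift (isCuntzKriegerFamily_gauge z)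

theorem gaugeHom_comp (z w : Circle) :
    (gaugeHom G z).comp (gaugeHom G w) = gaugeHom G (z * w) := by
  refine hom_ext (fun v => ?_) (fun e => ?_)
  · simp [gaugeHom]
  · simp [gaugeHom, smul_smul, mul_comm]

theorem gaugeHom_one : gaugeHom G 1 = StarAlgHom.id ℂ G.CStar := by
  refine hom_ext (fun v => ?_) (fun e => ?_)
  · simp [gaugeHom]
  · simp [gaugeHom]

variable (G) in
/-- The gauge action of the circle on the graph C*-algebra:
`γ_z (p v) = p v` and `γ_z (s e) = z s e`. -/
def gauge : Circle →* (G.CStar ≃⋆ₐ[ℂ] G.CStar) where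
  toFun z := StarAlgEquiv.ofStarAlgHom (gaugeHom G z) (gaugeHom G z⁻¹)
    (by rw [gaugeHom_comp, inv_mul_cancel, gaugeHom_one])
    (by rw [gaugeHom_comp, mul_inv_cancel, gaugeHom_one])
  map_one' := StarAlgEquiv.ext fun a => congrArg (fun f => f a) (gaugeHom_one (G := G))
  map_mul' z w := StarAlgEquiv.ext fun a =>
    (congrArg (fun f => f a) (gaugeHom_comp (G := G) z w)).symm

theorem gauge_p (z : Circle) (v : V) : gauge G z (p G v) = p G v :=
  lift_p (isCuntzKriegerFamily_gauge z) v

theorem gauge_s (z : Circle) (e : E) : gauge G z (s G e) = (z : ℂ) • s G e :=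
  lift_s (isCuntzKriegerFamily_gauge z) e

variable (G) in
/-- The dynamics `α_t = γ_{exp (i t)}` on the graph C*-algebra. -/
def dynamics (t : ℝ) : G.CStar ≃⋆ₐ[ℂ] G.CStar := gauge G (Circle.exp t)

end CStar

end DirGraph

/-! ## KMS states -/

/-- A state of a unital C*-algebra: a positive linear functional of value `1` at the unit. -/
structure IsCStarState {A : Type*} [CStarAlgebra A] (φ : A →L[ℂ] ℂ) : Prop where
  nonneg : ∀ a, 0 ≤ φ (star a * a)
  map_one : φ 1 = 1

/-- `f` is the entire extension of `t ↦ α_t a`; an element `a` is analytic for `α` if it has such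
an extension `f`, and then `α_z a = f z` for complex `z`. -/
structure IsEntireOrbit {A : Type*} [CStarAlgebra A] (α : ℝ → A ≃⋆ₐ[ℂ] A) (a : A) (f : ℂ → A) :
    Prop where
  differentiable : Differentiable ℂ f
  eq_orbit : ∀ t : ℝ, f t = α t a

/-- `φ` is a KMS state of inverse temperature `β` for the dynamics `α`: it is a state with
`φ (a b) = φ (b α_{iβ}(a))` for all analytic elements `a` and `b`. As is customary, the KMS states
of inverse temperature `0` are the traces that are invariant under the dynamics (for `β ≠ 0`
invariance is automatic). -/
structure IsKMSState {A : Type*} [CStarAlgebra A] (α : ℝ → A ≃⋆ₐ[ℂ] A) (β : ℝ) (φ : A →L[ℂ] ℂ) :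
    Prop where
  isState : IsCStarState φ
  kms : ∀ a b : A, ∀ f g : ℂ → A, IsEntireOrbit α a f → IsEntireOrbit α b g →
    φ (a * b) = φ (b * f (Complex.I * β))
  invariant : β = 0 → ∀ t a, φ (α t a) = φ a

end

/-! Uniqueness and the value of β. Applied to s_e s_e^*, the KMS condition gives φ(s_e s_e^*) =
e^{-β} φ(p_{s(e)}), so by the Cuntz-Krieger relation the probability vector m_v = φ(p_v) is an
eigenvector of the vertex matrix with eigenvalue e^β (`edgeOp_isKMSState`). Perron-Frobenius theory
for a strongly connected graph forces m > 0 and e^β = ρ(A), and leaves only one such m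
(`eigenvector_pos`, `rho_eq_of_eigenvector`, `eigenvector_unique`). The vector m determines φ: the
elements s_μ p_v s_ν^* have dense span, φ vanishes on those with |μ| ≠ |ν|, and the KMS condition
strips a letter from each word of the others (`isKMSState_ext`).

Existence. Let c = 1/ρ(A) and T(a) = c ∑ s_e^* a s_e. A functional fixed by T satisfies φ(p_v a) =
φ(a p_v), hence φ(s_e a) = c φ(a s_e): the KMS identity on generators. It passes to words, and then
to analytic elements by the identity theorem (`isKMSState_of_fixed`). The fixed state comes from
Markov-Kakutani averaging (`exists_comp_eq_self_of_convex`) over the states with φ(p_v) = m_v, where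
m is the Perron-Frobenius vector. T need not be unital, but the eigenvector equation makes it
preserve this set. The set is nonempty because ℓ²(V × ℕ) carries a Cuntz-Krieger family with all
vertex projections nonzero (`exists_state_p_eq`).

Invariance under the dynamics is part of the definition at β = 0, and the analytic continuation uses
it at every β. It is obtained by a prior averaging over the automorphism at time 1, which commutes
with T. Since π is irrational, invariance at time 1 makes φ vanish in every nonzero degree, so φ is
invariant at all times. -/

noncomputable section

/-! ## Perron-Frobenius theory of the edge operator -/

namespace DirGraph

variable {V E : Type*} [Fintype E] (G : DirGraph V E)

open Classical in
/-- Multiplication by the vertex matrix, on real vectors. -/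
def edgeOp : (V → ℝ) →ₗ[ℝ] (V → ℝ) where
  toFun x v := ∑ e with G.rng e = v, x (G.src e)
  map_add' x y := by ext v; simp [Finset.sum_add_distrib]
  map_smul' c x := by ext v; simp [Finset.mul_sum]

open Classical in
theorem edgeOp_apply (x : V → ℝ) (v : V) :
    G.edgeOp x v = ∑ e with G.rng e = v, x (G.src e) := rfl

theorem edgeOp_nonneg {x : V → ℝ} (hx : 0 ≤ x) : 0 ≤ G.edgeOp x :=
  fun _ => Finset.sum_nonneg fun _ _ => hx _

theorem le_edgeOp {x : V → ℝ} (hx : 0 ≤ x) (e : E) : x (G.src e) ≤ G.edgeOp x (G.rng e) := by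
  classical
  rw [edgeOp_apply]
  exact Finset.single_le_sum (f := fun e => x (G.src e)) (fun _ _ => hx _) (by simp)

theorem edgeOp_pow_nonneg {x : V → ℝ} (hx : 0 ≤ x) (k : ℕ) : 0 ≤ (G.edgeOp ^ k) x := by
  induction k with
  | zero => simpa using hx
  | succ k ih => rw [pow_succ']; exact G.edgeOp_nonneg ih

-- A path of length k from w to v contributes the term x_w to the v-entry of A^k x, and for
-- nonnegative x all other terms are nonnegative. All positivity statements below use strong
-- connectivity in this form.
variable {G} in
theorem HasPath.exists_le_pow {v w : V} (h : G.HasPath v w) :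
    ∃ k : ℕ, ∀ x : V → ℝ, 0 ≤ x → x w ≤ (G.edgeOp ^ k) x v := by
  induction h using Relation.ReflTransGen.head_induction_on with
  | refl => exact ⟨0, fun x _ => by simp⟩
  | head h _ ih =>
    obtain ⟨e, rfl, rfl⟩ := h
    obtain ⟨k, hk⟩ := ih
    refine ⟨k + 1, fun x hx => (hk x hx).trans ?_⟩
    rw [pow_succ']
    exact G.le_edgeOp (G.edgeOp_pow_nonneg hx k) e

theorem edgeOp_pow_eigen {x : V → ℝ} {l : ℝ} (h : G.edgeOp x = l • x) (k : ℕ) :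
    (G.edgeOp ^ k) x = l ^ k • x := by
  induction k with
  | zero => simp
  | succ k ih => rw [pow_succ', Module.End.mul_apply, ih, map_smul, h, smul_smul, pow_succ]

variable {G}

/-- Choose w with x_w > 0 and a path of length k from w to v: then 0 < x_w ≤ l^k x_v, so x_v cannot
vanish. No sign of l is needed. -/
theorem IsStronglyConnected.eigenvector_pos (hG : G.IsStronglyConnected) {x : V → ℝ} {l : ℝ}
    (h : G.edgeOp x = l • x) (hx : 0 ≤ x) (h0 : x ≠ 0) (v : V) : 0 < x v := by
  obtain ⟨w, hw⟩ := Function.ne_iff.mp h0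
  have hw : 0 < x w := lt_of_le_of_ne (hx w) (Ne.symm hw)
  obtain ⟨k, hk⟩ := (hG v w).exists_le_pow
  have h1 := hk x hx
  rw [G.edgeOp_pow_eigen h, Pi.smul_apply, smul_eq_mul] at h1
  refine lt_of_le_of_ne (hx v) fun h2 => ?_
  rw [← h2, mul_zero] at h1
  exact absurd h1 hw.not_ge

theorem IsStronglyConnected.eigenvalue_pos [Nonempty E] (hG : G.IsStronglyConnected) {x : V → ℝ}
    {l : ℝ} (h : G.edgeOp x = l • x) (hx : 0 ≤ x) (h0 : x ≠ 0) : 0 < l := by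
  obtain ⟨e⟩ := ‹Nonempty E›
  have h1 := G.le_edgeOp hx e
  rw [h, Pi.smul_apply, smul_eq_mul] at h1
  exact pos_of_mul_pos_left ((hG.eigenvector_pos h hx h0 _).trans_le h1) (hx _)

variable [Fintype V]

/-- The positive eigenvectors of an eigenvalue are proportional. -/
theorem IsStronglyConnected.eigenvector_unique [Nonempty E] (hG : G.IsStronglyConnected)
    {x y : V → ℝ} {l : ℝ} (hx : G.edgeOp x = l • x) (hy : G.edgeOp y = l • y)
    (hx0 : 0 ≤ x) (hy0 : 0 ≤ y) (hx1 : ∑ v, x v = 1) (hy1 : ∑ v, y v = 1) : x = y := by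
  have hne : ∀ z : V → ℝ, ∑ v, z v = 1 → z ≠ 0 := by rintro z hz rfl; simp at hz
  have hxp := hG.eigenvector_pos hx hx0 (hne x hx1)
  have hyp := hG.eigenvector_pos hy hy0 (hne y hy1)
  have : Nonempty V := ‹Nonempty E›.map G.rng
  -- With t the smallest ratio, x - t y is a nonnegative eigenvector with a zero entry at w, so
  -- strict positivity forces it to be zero. Equal sums then give t = 1.
  obtain ⟨w, hw⟩ := Finite.exists_min fun v => x v / y v
  set t := x w / y w
  have ht : 0 ≤ x - t • y := fun v => by
    have := (le_div_iff₀ (hyp v)).mp (hw v)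
    simpa using this
  have hz : x - t • y = 0 := by
    by_contra hz
    have h1 := hG.eigenvector_pos (x := x - t • y) (l := l)
      (by rw [map_sub, map_smul, hx, hy, smul_sub, smul_comm]) ht hz w
    simp [t, div_mul_cancel₀ _ (hyp w).ne'] at h1
  have hxy : ∀ v, x v = t * y v := fun v => by simpa [sub_eq_zero] using congrFun hz v
  have ht1 : t = 1 := by
    rw [← hx1]; simp only [hxy]; rw [← Finset.mul_sum, hy1, mul_one]
  ext v; rw [hxy, ht1, one_mul]

/-- The Collatz-Wielandt argument for the existence of a Perron-Frobenius eigenvector. -/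
theorem IsStronglyConnected.exists_eigenvector [Nonempty V] (hG : G.IsStronglyConnected) :
    ∃ (x : V → ℝ) (l : ℝ), 0 ≤ x ∧ ∑ v, x v = 1 ∧ G.edgeOp x = l • x := by
  classical
  have hcont : Continuous G.edgeOp := LinearMap.continuous_of_finiteDimensional _
  -- The cap on l makes the feasible set compact without excluding anything: if l x ≤ A x with x in
  -- the simplex, summing entries gives l ≤ ∑ (A x)_v ≤ B.
  set B : ℝ := Fintype.card V * Fintype.card E
  let K : Set ((V → ℝ) × ℝ) :=
    (stdSimplex ℝ V ×ˢ Set.Icc 0 B) ∩ {q | q.2 • q.1 ≤ G.edgeOp q.1}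
  have hK : IsCompact K := by
    refine ((isCompact_stdSimplex ℝ V).prod isCompact_Icc).inter_right ?_
    exact isClosed_le (by fun_prop) (hcont.comp continuous_fst)
  have hsum : ∀ x ∈ stdSimplex ℝ V, ∑ v, G.edgeOp x v ≤ B := by
    rintro x ⟨hx, hx1⟩
    have hxv : ∀ v, x v ≤ 1 := fun v => hx1 ▸ Finset.single_le_sum (fun i _ => hx i) (by simp)
    have : ∀ v, G.edgeOp x v ≤ Fintype.card E := fun v => by
      rw [edgeOp_apply]
      refine (Finset.sum_le_card_nsmul _ _ 1 fun e _ => hxv _).trans ?_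
      simpa using Finset.card_le_univ _
    refine (Finset.sum_le_card_nsmul _ _ _ fun v _ => this v).trans ?_
    simp [B]
  have hne : K.Nonempty := by
    obtain ⟨v⟩ := ‹Nonempty V›
    refine ⟨(Pi.single v 1, 0), ⟨⟨single_mem_stdSimplex ℝ v, le_rfl, by positivity⟩, ?_⟩⟩
    simpa using G.edgeOp_nonneg (single_mem_stdSimplex ℝ v).1
  obtain ⟨⟨x, l⟩, ⟨⟨hx, hl⟩, hxl⟩, hmax⟩ := hK.exists_isMaxOn hne continuous_snd.continuousOn
  simp only [Set.mem_ofPred_eq] at hx hl hxl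
  refine ⟨x, l, hx.1, hx.2, ?_⟩
  by_contra hd
  -- If A x ≠ l x at the maximal l, apply a polynomial Q in A that makes nonzero nonnegative vectors
  -- strictly positive. Since Q commutes with A, y = Q x satisfies A y > l y in every entry, so l
  -- can be increased.
  choose k hk using fun v w => (hG v w).exists_le_pow
  let Q : Module.End ℝ (V → ℝ) := ∑ v, ∑ w, G.edgeOp ^ k v w
  have hQ : ∀ z : V → ℝ, 0 ≤ z → z ≠ 0 → ∀ v, 0 < Q z v := by
    intro z hz hz0 v
    obtain ⟨w, hw⟩ := Function.ne_iff.mp hz0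
    have hw : 0 < z w := lt_of_le_of_ne (hz w) (Ne.symm hw)
    refine hw.trans_le ((hk v w z hz).trans ?_)
    simp only [Q, LinearMap.sum_apply, Finset.sum_apply]
    have h0 : ∀ a b, 0 ≤ (G.edgeOp ^ k a b) z v := fun a b => G.edgeOp_pow_nonneg hz _ v
    exact (Finset.single_le_sum (f := fun b => (G.edgeOp ^ k v b) z v) (fun b _ => h0 v b)
      (Finset.mem_univ w)).trans (Finset.single_le_sum
        (f := fun a => ∑ b, (G.edgeOp ^ k a b) z v)
        (fun a _ => Finset.sum_nonneg fun b _ => h0 a b) (Finset.mem_univ v))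
  have hcomm : ∀ z, G.edgeOp (Q z) = Q (G.edgeOp z) := fun z => by
    simp only [Q, LinearMap.sum_apply, map_sum]
    refine Finset.sum_congr rfl fun a _ => Finset.sum_congr rfl fun b _ => ?_
    rw [← Module.End.mul_apply, ← Module.End.mul_apply, ← pow_succ, ← pow_succ']
  have hx0 : x ≠ 0 := by rintro rfl; simpa using hx.2
  have hy := hQ x hx.1 hx0
  have hQd := hQ (G.edgeOp x - l • x) (sub_nonneg.mpr hxl) (sub_ne_zero.mpr hd)
  rw [map_sub, map_smul, ← hcomm] at hQd
  set y := Q x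
  obtain ⟨w, hw⟩ := Finite.exists_min fun v => (G.edgeOp y - l • y) v / y v
  -- The smallest relative slack of A y over l y: the normalised y is feasible for l + ε,
  -- contradicting maximality.
  set ε := (G.edgeOp y - l • y) w / y w
  have hε : 0 < ε := div_pos (hQd w) (hy w)
  have hS : 0 < ∑ v, y v := Finset.sum_pos (fun v _ => hy v) Finset.univ_nonempty
  set c := (∑ v, y v)⁻¹
  have hc : 0 < c := inv_pos.mpr hS
  have hmem : c • y ∈ stdSimplex ℝ V := by
    refine ⟨fun v => (mul_pos hc (hy v)).le, ?_⟩
    simp only [Pi.smul_apply, smul_eq_mul, ← Finset.mul_sum]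
    exact inv_mul_cancel₀ hS.ne'
  have hle : (l + ε) • (c • y) ≤ G.edgeOp (c • y) := fun v => by
    have h1 := (le_div_iff₀ (hy v)).mp (hw v)
    simp only [Pi.sub_apply, Pi.smul_apply, smul_eq_mul, map_smul] at h1 ⊢
    have := mul_le_mul_of_nonneg_left h1 hc.le
    linarith
  have hB : l + ε ≤ B := by
    have h2 : ∑ v, ((l + ε) • (c • y)) v = l + ε := by
      simp only [Pi.smul_apply _ (c • y), smul_eq_mul, ← Finset.mul_sum, hmem.2, mul_one]
    rw [← h2]
    exact (Finset.sum_le_sum fun v _ => hle v).trans (hsum _ hmem)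
  have := hmax (a := (c • y, l + ε)) ⟨⟨hmem, by simp only; linarith [hl.1], hB⟩, hle⟩
  simp only [Set.mem_ofPred_eq] at this
  linarith

open Classical in
theorem vertexMatrix_mulVec (z : V → ℂ) (v : V) :
    ((G.vertexMatrix.map (fun n : ℤ => (n : ℂ))).mulVec z) v
      = ∑ e with G.rng e = v, z (G.src e) := by
  rw [← Finset.sum_fiberwise (s := Finset.univ.filter fun e => G.rng e = v) (g := G.src)]
  simp only [Matrix.mulVec, dotProduct, vertexMatrix, Matrix.map_apply, Matrix.of_apply]
  refine Finset.sum_congr rfl fun w _ => ?_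
  rw [Finset.filter_filter, Finset.sum_congr rfl (g := fun _ => z w) (fun e he => by
    rw [(Finset.mem_filter.mp he).2.2]), Finset.sum_const, Nat.card_eq_fintype_card,
    Fintype.card_subtype, nsmul_eq_mul]
  simp

/-- The spectral radius is the eigenvalue of any positive eigenvector. -/
theorem rho_eq_of_eigenvector [Nonempty V] {x : V → ℝ} {l : ℝ} (hl : 0 < l)
    (h : G.edgeOp x = l • x) (hx : ∀ v, 0 < x v) : G.rho = l := by
  classical
  set M := G.vertexMatrix.map (fun n : ℤ => (n : ℂ))
  have hspec : ∀ μ : ℂ, μ ∈ spectrum ℂ M ↔ ∃ z : V → ℂ, z ≠ 0 ∧ M.mulVec z = μ • z := by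
    intro μ
    rw [← Matrix.spectrum_toLin', ← Module.End.hasEigenvalue_iff_mem_spectrum]
    constructor
    · intro hμ
      obtain ⟨z, hz⟩ := hμ.exists_hasEigenvector
      exact ⟨z, hz.2, by simpa using hz.apply_eq_smul⟩
    · rintro ⟨z, hz, hzμ⟩
      exact Module.End.hasEigenvalue_of_hasEigenvector (x := z)
        ⟨Module.End.mem_eigenspace_iff.mpr (by simpa using hzμ), hz⟩
  have hxv : ∀ v, ∑ e with G.rng e = v, x (G.src e) = l * x v := fun v => congrFun h v
  have key : spectralRadius ℂ M = ENNReal.ofReal l := by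
    refine le_antisymm (iSup₂_le fun μ hμ => ?_) ?_
    · obtain ⟨z, hz, hzμ⟩ := (hspec μ).mp hμ
      -- The sup norm weighted by x is the right one: |z| ≤ t x entrywise gives |A z| ≤ t A x = l t
      -- x, and at the maximising w this reads |μ| ≤ l.
      obtain ⟨w, hw⟩ := Finite.exists_max fun v => ‖z v‖ / x v
      set t := ‖z w‖ / x w
      have hle : ∀ v, ‖z v‖ ≤ t * x v := fun v => (div_le_iff₀ (hx v)).mp (hw v)
      have ht : 0 < t := by
        obtain ⟨u, hu⟩ := Function.ne_iff.mp hz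
        exact (div_pos (norm_pos_iff.mpr hu) (hx u)).trans_le (hw u)
      have hzw : ‖z w‖ = t * x w := (div_mul_cancel₀ _ (hx w).ne').symm
      have h1 : ‖μ‖ * ‖z w‖ ≤ l * ‖z w‖ := by
        rw [← norm_mul, ← smul_eq_mul, ← Pi.smul_apply, ← hzμ, vertexMatrix_mulVec]
        calc ‖∑ e with G.rng e = w, z (G.src e)‖ ≤ ∑ e with G.rng e = w, t * x (G.src e) :=
              norm_sum_le_of_le _ fun e _ => hle _
          _ = l * ‖z w‖ := by rw [← Finset.mul_sum, hxv, hzw]; ring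
      have h2 : ‖μ‖ ≤ l := le_of_mul_le_mul_right h1 (hzw ▸ mul_pos ht (hx w))
      rw [← enorm_eq_nnnorm, ← ofReal_norm]
      exact ENNReal.ofReal_le_ofReal h2
    · have hmem : (l : ℂ) ∈ spectrum ℂ M := by
        rw [hspec]
        refine ⟨fun v => (x v : ℂ), fun h0 => ?_, ?_⟩
        · obtain ⟨v⟩ := ‹Nonempty V›
          exact (hx v).ne' (by simpa using congrFun h0 v)
        · ext v
          rw [vertexMatrix_mulVec, ← Complex.ofReal_sum, hxv]
          simp
      refine le_trans ?_ (le_iSup₂ (f := fun (k : ℂ) (_ : k ∈ spectrum ℂ M) => (‖k‖₊ : ENNReal))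
        (l : ℂ) hmem)
      rw [← enorm_eq_nnnorm, ← ofReal_norm, Complex.norm_real, Real.norm_of_nonneg hl.le]
  rw [rho]
  convert congrArg ENNReal.toReal key
  exact (ENNReal.toReal_ofReal hl.le).symm

end DirGraph

/-! ## Partial permutation operators and a faithful Cuntz-Krieger family -/

namespace PEquiv

variable {ι : Type*}

/-- Composition with a partial permutation, extended by zero. -/
def pullback (g : ι ≃. ι) (x : ι → ℂ) (i : ι) : ℂ := (g i).elim 0 x

/-- A partial permutation is injective where it is defined, so the nonzero terms are values of `x`
at distinct indices. -/
theorem pullback_sum_le (g : ι ≃. ι) (x : lp (fun _ : ι => ℂ) 2) (s : Finset ι) :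
    ∑ i ∈ s, ‖g.pullback x i‖ ^ (2 : ENNReal).toReal ≤ ‖x‖ ^ (2 : ENNReal).toReal := by
  classical
  have h2 : (0 : ℝ) < (2 : ENNReal).toReal := by norm_num
  have h0 : ∀ i ∈ s, i ∉ s.filter (fun i => (g i).isSome) →
      ‖g.pullback x i‖ ^ (2 : ENNReal).toReal = 0 := by
    intro i hi hi'
    have : g i = none := by simpa [hi] using hi'
    simp [pullback, this]
  rw [← Finset.sum_subset (Finset.filter_subset _ s) h0]
  rw [← Finset.sum_attach]
  have hsome : ∀ i : {i // i ∈ s.filter (fun i => (g i).isSome)}, (g i.1).isSome :=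
    fun i => (Finset.mem_filter.mp i.2).2
  let f : {i // i ∈ s.filter (fun i => (g i).isSome)} → ι := fun i => (g i.1).get (hsome i)
  have hf : ∀ i, g i.1 = some (f i) := fun i => (Option.some_get _).symm
  have hinj : Function.Injective f := fun i j hij => Subtype.ext
    (g.inj (hf i) (by rw [hij]; exact hf j))
  calc _ = ∑ i ∈ (s.filter (fun i => (g i).isSome)).attach, ‖x (f i)‖ ^ (2 : ENNReal).toReal :=
        Finset.sum_congr rfl fun i _ => by simp [pullback, hf]
    _ = ∑ j ∈ ((s.filter (fun i => (g i).isSome)).attach.image f),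
          ‖x j‖ ^ (2 : ENNReal).toReal := by
        rw [Finset.sum_image fun i _ j _ h => hinj h]
    _ ≤ _ := lp.sum_rpow_le_norm_rpow h2 x _

/-- The operator on square-summable families given by a partial permutation. -/
def toCLM (g : ι ≃. ι) : lp (fun _ : ι => ℂ) 2 →L[ℂ] lp (fun _ : ι => ℂ) 2 :=
  LinearMap.mkContinuous
    { toFun := fun x => ⟨g.pullback x, memℓp_gen' (g.pullback_sum_le x)⟩
      map_add' := fun x y => by
        ext i
        change (g i).elim 0 (fun j => x j + y j) = (g i).elim 0 x + (g i).elim 0 y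
        cases g i <;> simp
      map_smul' := fun c x => by
        ext i
        change (g i).elim 0 (fun j => c * x j) = c * (g i).elim 0 x
        cases g i <;> simp } 1 fun x => by
    rw [one_mul]
    exact lp.norm_le_of_forall_sum_le (by norm_num) (norm_nonneg _) (g.pullback_sum_le x)

theorem toCLM_apply (g : ι ≃. ι) (x : lp (fun _ : ι => ℂ) 2) (i : ι) :
    g.toCLM x i = (g i).elim 0 x := rfl

/-- The order of the factors is not reversed: `trans` applies `g` first, and pulling back reverses
composition once more. -/
theorem toCLM_trans (g h : ι ≃. ι) : (g.trans h).toCLM = g.toCLM * h.toCLM := by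
  ext x i
  rw [mul_apply_eq_comp, toCLM_apply, toCLM_apply]
  change ((g i).bind h).elim 0 x = _
  cases hg : g i <;> simp [toCLM_apply]

/-- Both inner products sum conj(x_i) y_j over the pairs with g(i) = j, indexed once by i and once
by j. -/
theorem star_toCLM (g : ι ≃. ι) : star g.toCLM = g.symm.toCLM := by
  rw [ContinuousLinearMap.star_eq_adjoint]
  refine Eq.symm ((ContinuousLinearMap.eq_adjoint_iff _ _).mpr fun x y => ?_)
  rw [lp.inner_eq_tsum, lp.inner_eq_tsum]
  have hsome : ∀ i : Function.support (fun i => inner ℂ (x i) (g.toCLM y i)),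
      ∃ j, g i.1 = some j := by
    rintro ⟨i, hi⟩
    rw [← Option.ne_none_iff_exists']
    intro h
    exact hi (by simp [toCLM_apply, h])
  choose f hf using hsome
  have hf' : ∀ i, g.symm (f i) = some i.1 := fun i => (g.eq_some_iff).mpr (hf i)
  refine tsum_eq_tsum_of_ne_zero_bij f ?_ ?_ ?_
  · intro i j hij
    exact Subtype.ext (g.inj (hf i) (by rw [hij]; exact hf j))
  · intro j hj
    cases h : g.symm j with
    | none => exact absurd (by simp [toCLM_apply, h]) hj
    | some i =>
      have hi : g i = some j := (g.eq_some_iff).mp h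
      have hmem : i ∈ Function.support (fun i => inner ℂ (x i) (g.toCLM y i)) := fun h0 => hj (by
        simpa [toCLM_apply, h, hi] using h0)
      exact ⟨⟨i, hmem⟩, Option.some_injective _ ((hf ⟨i, hmem⟩).symm.trans hi)⟩
  · intro i
    simp only [toCLM_apply, hf', hf]
    simp

theorem toCLM_ofSet_apply (s : Set ι) [DecidablePred (· ∈ s)] (x : lp (fun _ : ι => ℂ) 2) (i : ι) :
    (ofSet s).toCLM x i = if i ∈ s then x i else 0 := by
  rw [toCLM_apply]
  change (if i ∈ s then some i else none).elim 0 _ = _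
  split_ifs <;> rfl

end PEquiv

namespace DirGraph

variable {V E : Type*} {G : DirGraph V E}

theorem IsStronglyConnected.surjective_rng [Nonempty E] (hG : G.IsStronglyConnected) :
    Function.Surjective G.rng := by
  intro v
  obtain ⟨e⟩ := ‹Nonempty E›
  rcases Relation.ReflTransGen.cases_head (hG v (G.rng e)) with h | ⟨_, ⟨f, hf, _⟩, _⟩
  · exact ⟨e, h.symm⟩
  · exact ⟨f, hf⟩

/-- The factor ℕ absorbs multiplicities: each vertex receives at least one and at most finitely many
edges, so the edges into it times ℕ form a countably infinite set, in bijection with the copy of ℕ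
over that vertex. -/
theorem exists_equiv_fst_eq_rng [Finite E] (hG : Function.Surjective G.rng) :
    ∃ θ : E × ℕ ≃ V × ℕ, ∀ q, (θ q).1 = G.rng q.1 := by
  have hne : ∀ v, Nonempty ({e // G.rng e = v} × ℕ ≃ ℕ) := fun v => by
    obtain ⟨e, he⟩ := hG v
    have : Nonempty {e // G.rng e = v} := ⟨⟨e, he⟩⟩
    exact nonempty_equiv_of_countable
  let θ₁ : E × ℕ ≃ (Σ v, {e // G.rng e = v}) × ℕ :=
    (Equiv.sigmaFiberEquiv G.rng).symm.prodCongr (Equiv.refl ℕ)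
  let θ₂ : (Σ v, {e // G.rng e = v}) × ℕ ≃ Σ v, {e // G.rng e = v} × ℕ :=
    { toFun := fun q => ⟨q.1.1, q.1.2, q.2⟩
      invFun := fun q => (⟨q.1, q.2.1⟩, q.2.2)
      left_inv := fun _ => rfl
      right_inv := fun _ => rfl }
  let θ₃ : (Σ v, {e // G.rng e = v} × ℕ) ≃ V × ℕ :=
    (Equiv.sigmaCongrRight fun v => (hne v).some).trans (Equiv.sigmaEquivProd V ℕ)
  exact ⟨(θ₁.trans θ₂).trans θ₃, fun _ => rfl⟩

variable (G) in
open Classical in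
/-- The partial permutation `θ (e, n) ↦ (src e, n)` of an edge `e`. -/
def edgePEquiv (θ : E × ℕ ≃ V × ℕ) (e : E) : V × ℕ ≃. V × ℕ where
  toFun i := if (θ.symm i).1 = e then some (G.src e, (θ.symm i).2) else none
  invFun j := if j.1 = G.src e then some (θ (e, j.2)) else none
  inv i j := by
    obtain ⟨q, rfl⟩ := θ.surjective i
    obtain ⟨f, n⟩ := q
    obtain ⟨w, k⟩ := j
    simp only [Equiv.symm_apply_apply, Option.ite_none_right_eq_some,
      Option.some.injEq, EmbeddingLike.apply_eq_iff_eq, Prod.mk.injEq]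
    constructor
    · rintro ⟨rfl, rfl, rfl⟩; exact ⟨rfl, rfl, rfl⟩
    · rintro ⟨rfl, rfl, rfl⟩; exact ⟨rfl, rfl, rfl⟩

variable [Fintype V] [Fintype E]

open Classical in
/-- The Cuntz-Krieger family attached to a bijection `E × ℕ ≃ V × ℕ` over the range map. -/
theorem isCuntzKriegerFamily_toCLM (θ : E × ℕ ≃ V × ℕ) (hθ : ∀ q, (θ q).1 = G.rng q.1) :
    G.IsCuntzKriegerFamily (fun v => (PEquiv.ofSet (Prod.fst ⁻¹' {v} : Set (V × ℕ))).toCLM)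
      (fun e => (G.edgePEquiv θ e).toCLM) where
  star_P v := by rw [PEquiv.star_toCLM, PEquiv.ofSet_symm]
  P_mul_P_self v := by
    ext x i
    simp only [mul_apply_eq_comp, PEquiv.toCLM_ofSet_apply]
    split_ifs <;> rfl
  P_mul_P v w hvw := by
    ext x i
    rw [mul_apply_eq_comp, PEquiv.toCLM_ofSet_apply, PEquiv.toCLM_ofSet_apply]
    by_cases h : i.1 = v
    · simp [h, hvw]
    · simp [h]
  sum_P := by
    ext x i
    simp only [sum_apply, lp.coeFn_sum, Finset.sum_apply, PEquiv.toCLM_ofSet_apply]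
    simp
  star_S_mul_S e := by
    rw [PEquiv.star_toCLM, ← PEquiv.toCLM_trans]
    congr 1
    ext1 i
    change ((G.edgePEquiv θ e).symm i).bind (G.edgePEquiv θ e) = _
    by_cases h : i.1 = G.src e
    · obtain ⟨w, n⟩ := i
      subst h
      simp [PEquiv.ofSet, edgePEquiv, PEquiv.symm]
    · simp [PEquiv.ofSet, edgePEquiv, PEquiv.symm, h]
  P_eq_sum v := by
    ext x i
    have hSS : ∀ e, ((G.edgePEquiv θ e).toCLM * star (G.edgePEquiv θ e).toCLM) x i
        = if (θ.symm i).1 = e then x i else 0 := fun e => by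
      rw [PEquiv.star_toCLM, ← PEquiv.toCLM_trans, PEquiv.toCLM_apply]
      change (((G.edgePEquiv θ e) i).bind (G.edgePEquiv θ e).symm).elim 0 _ = _
      by_cases h : (θ.symm i).1 = e
      · subst h
        simp [edgePEquiv, PEquiv.symm]
      · simp [edgePEquiv, h]
    simp only [sum_apply, lp.coeFn_sum, Finset.sum_apply, hSS]
    have hi : i.1 = G.rng (θ.symm i).1 := by rw [← hθ, Equiv.apply_symm_apply]
    rw [Finset.sum_ite_eq, PEquiv.toCLM_ofSet_apply]
    simp [← hi]

end DirGraph

/-! ## States with prescribed values on the vertex projections -/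

section MarkovKakutani

open Filter Topology

variable {A : Type*} [NormedAddCommGroup A] [NormedSpace ℂ A]

/-- A Markov-Kakutani fixed point theorem: if a nonempty convex bounded weak-* closed set of
functionals is invariant under composition with `T`, it contains a functional fixed by `T`. -/
theorem exists_comp_eq_self_of_convex (K : Set (A →L[ℂ] ℂ)) (hne : K.Nonempty) (hconv : Convex ℝ K)
    (C : ℝ) (hC0 : 0 ≤ C) (hC : ∀ φ ∈ K, ∀ a, ‖φ a‖ ≤ C * ‖a‖)
    (hclosed : ∀ (ψ : ℕ → A →L[ℂ] ℂ) (φ : A →L[ℂ] ℂ) (F : Ultrafilter ℕ), (∀ n, ψ n ∈ K) →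
      (∀ a, Tendsto (fun n => ψ n a) F (𝓝 (φ a))) → φ ∈ K)
    (T : A →L[ℂ] A) (hT : ∀ φ ∈ K, φ.comp T ∈ K) : ∃ φ ∈ K, φ.comp T = φ := by
  obtain ⟨φ₀, h₀⟩ := hne
  have hpow : ∀ n : ℕ, φ₀.comp (T ^ n) ∈ K := fun n => by
    induction n with
    | zero => simpa using! h₀
    | succ n ih => rw [pow_succ]; exact hT _ ih
  -- Cesàro averages of the orbit of φ₀. Composing with T changes them only by a telescoping
  -- boundary term of size at most 2C‖a‖/(N+1).
  let ψ : ℕ → A →L[ℂ] ℂ := fun N =>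
    ∑ n ∈ Finset.range (N + 1), ((N + 1 : ℝ)⁻¹) • φ₀.comp (T ^ n)
  have hψ : ∀ N, ψ N ∈ K := fun N => by
    refine hconv.sum_mem (fun _ _ => by positivity) ?_ fun n _ => hpow n
    rw [Finset.sum_const, Finset.card_range, nsmul_eq_mul]
    push_cast
    exact mul_inv_cancel₀ (by positivity)
  have hdiff : ∀ N a, ψ N (T a) - ψ N a
      = ((N + 1 : ℝ)⁻¹) • (φ₀ ((T ^ (N + 1)) a) - φ₀ a) := fun N a => by
    simp only [ψ, sum_apply, smul_apply, ← Finset.smul_sum, ← smul_sub,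
      ← Finset.sum_sub_distrib, ContinuousLinearMap.comp_apply]
    congr 1
    have : ∀ n, φ₀ ((T ^ n) (T a)) = φ₀ ((T ^ (n + 1)) a) := fun n => by rw [pow_succ]; rfl
    simp only [this]
    exact Finset.sum_range_sub (fun n => φ₀ ((T ^ n) a)) (N + 1)
  have hlim0 : ∀ a, Tendsto (fun N => ψ N (T a) - ψ N a) atTop (𝓝 0) := fun a => by
    rw [tendsto_zero_iff_norm_tendsto_zero]
    have hb : Tendsto (fun N : ℕ => 1 / ((N : ℝ) + 1) * (2 * (C * ‖a‖))) atTop (𝓝 0) := by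
      simpa using tendsto_one_div_add_atTop_nhds_zero_nat.mul_const (2 * (C * ‖a‖))
    refine squeeze_zero (fun _ => norm_nonneg _) (fun N => ?_) hb
    rw [hdiff, norm_smul, norm_inv, Real.norm_of_nonneg (by positivity), one_div]
    refine mul_le_mul_of_nonneg_left ((norm_sub_le _ _).trans ?_) (by positivity)
    have h1 := hC _ (hpow (N + 1)) a
    have h2 := hC _ h₀ a
    rw [ContinuousLinearMap.comp_apply] at h1
    linarith
  -- The weak-* compact ball need not be sequentially compact, so the limit is taken along a free
  -- ultrafilter.
  let F : Ultrafilter ℕ := hyperfilter ℕ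
  have hF : (F : Filter ℕ) ≤ atTop := by
    rw [← Nat.cofinite_eq_atTop]; exact hyperfilter_le_cofinite
  have hcpt := WeakDual.isCompact_closedBall (𝕜 := ℂ) (E := A) 0 C
  obtain ⟨φ', -, hφ'⟩ := isCompact_iff_ultrafilter_le_nhds'.mp hcpt
    (F.map fun n => StrongDual.toWeakDual (ψ n)) (by
      refine Ultrafilter.mem_map.mpr (Filter.univ_mem' fun n => ?_)
      change WeakDual.toStrongDual (StrongDual.toWeakDual (ψ n)) ∈ Metric.closedBall 0 C
      rw [mem_closedBall_zero_iff]
      exact ContinuousLinearMap.opNorm_le_bound _ hC0 (hC _ (hψ n)))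
  let φ : A →L[ℂ] ℂ := WeakDual.toStrongDual φ'
  have hlim : ∀ a, Tendsto (fun n => ψ n a) F (𝓝 (φ a)) := fun a =>
    ((WeakDual.eval_continuous a).tendsto φ').comp (f := fun n => StrongDual.toWeakDual (ψ n)) hφ'
  refine ⟨φ, hclosed ψ φ F hψ hlim, ?_⟩
  ext a
  have h1 := (hlim (T a)).sub (hlim a)
  exact sub_eq_zero.mp (tendsto_nhds_unique h1 ((hlim0 a).mono_left hF))

end MarkovKakutani

/-! ### Bounds, limits, convex combinations and vector states -/

namespace IsCStarState

variable {A : Type*} [CStarAlgebra A] {φ : A →L[ℂ] ℂ}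

/-- Write `a` as a combination of four positive elements of norm at most ‖a‖. The constant 4 is not
sharp; a bound uniform over all states is enough for weak-* compactness. -/
theorem norm_apply_le (h : IsCStarState φ) (a : A) : ‖φ a‖ ≤ 4 * ‖a‖ := by
  let _ := CStarAlgebra.spectralOrder A
  have _ := CStarAlgebra.spectralOrderedRing A
  have hnn : ∀ x : A, 0 ≤ x → 0 ≤ φ x := fun x hx => by
    obtain ⟨y, rfl⟩ := CStarAlgebra.nonneg_iff_eq_star_mul_self.mp hx
    exact h.nonneg y
  let f : A →ₚ[ℂ] ℂ := PositiveLinearMap.mk₀ φ.toLinearMap hnn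
  obtain ⟨y, hy0, hy1, hy⟩ := CStarAlgebra.exists_sum_four_nonneg a
  have hb : ∀ i, ‖φ (y i)‖ ≤ ‖a‖ := fun i => by
    have h1 : ‖φ (y i)‖ ≤ ‖φ 1‖ * ‖y i‖ := f.norm_apply_le_of_nonneg (y i) (hy0 i)
    rw [h.map_one, norm_one, one_mul] at h1
    exact h1.trans (hy1 i)
  rw [hy, map_sum]
  refine (norm_sum_le_of_le (n := fun _ => ‖a‖) _ fun i _ => ?_).trans ?_
  · rw [map_smul, norm_smul, norm_pow, Complex.norm_I, one_pow, one_mul]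
    exact hb i
  · rw [← hy]; simp

end IsCStarState

theorem Complex.nonneg_of_tendsto {α : Type*} {F : Filter α} [F.NeBot] {u : α → ℂ} {z : ℂ}
    (h : Filter.Tendsto u F (nhds z)) (hu : ∀ n, 0 ≤ u n) : 0 ≤ z := by
  rw [Complex.nonneg_iff]
  constructor
  · exact ge_of_tendsto' ((Complex.continuous_re.tendsto z).comp h)
      fun n => (Complex.nonneg_iff.mp (hu n)).1
  · exact tendsto_nhds_unique (tendsto_const_nhds.congr fun n => (Complex.nonneg_iff.mp (hu n)).2)
      ((Complex.continuous_im.tendsto z).comp h)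

/-- States are closed under pointwise limits. -/
theorem IsCStarState.of_tendsto {A : Type*} [CStarAlgebra A] {α : Type*} {F : Filter α} [F.NeBot]
    {ψ : α → A →L[ℂ] ℂ} {φ : A →L[ℂ] ℂ} (hψ : ∀ n, IsCStarState (ψ n))
    (h : ∀ a, Filter.Tendsto (fun n => ψ n a) F (nhds (φ a))) : IsCStarState φ where
  nonneg a := Complex.nonneg_of_tendsto (h _) fun n => (hψ n).nonneg a
  map_one := tendsto_nhds_unique (h 1) (tendsto_const_nhds.congr fun n => (hψ n).map_one.symm)

theorem convex_isCStarState (A : Type*) [CStarAlgebra A] :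
    Convex ℝ {φ : A →L[ℂ] ℂ | IsCStarState φ} := by
  intro φ hφ ψ hψ s t hs ht hst
  refine ⟨fun a => ?_, ?_⟩
  · have h1 := hφ.nonneg a
    have h2 := hψ.nonneg a
    simp only [add_apply, smul_apply]
    exact add_nonneg (smul_nonneg hs h1) (smul_nonneg ht h2)
  · simp only [add_apply, smul_apply, hφ.map_one, hψ.map_one]
    rw [← add_smul, hst, one_smul]

/-- The vector state of a unit vector in a representation. -/
theorem exists_vector_state {A H : Type*} [CStarAlgebra A] [NormedAddCommGroup H]
    [InnerProductSpace ℂ H] [CompleteSpace H] (π : A →⋆ₐ[ℂ] (H →L[ℂ] H)) (x : H) (hx : ‖x‖ = 1) :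
    ∃ φ : A →L[ℂ] ℂ, IsCStarState φ ∧ ∀ a, φ a = inner ℂ x (π a x) := by
  let f : A →ₗ[ℂ] ℂ :=
    { toFun := fun a => inner ℂ x (π a x)
      map_add' := fun a b => by rw [map_add, add_apply, inner_add_right]
      map_smul' := fun c a => by
        rw [map_smul, smul_apply, inner_smul_right]; rfl }
  refine ⟨f.mkContinuous 1 fun a => ?_, ⟨fun a => ?_, ?_⟩, fun a => rfl⟩
  · rw [one_mul]
    refine (norm_inner_le_norm x (π a x)).trans ?_
    rw [hx, one_mul]
    refine ((π a).le_opNorm x).trans ?_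
    rw [hx, mul_one]
    exact NonUnitalStarAlgHom.norm_apply_le π a
  · change 0 ≤ inner ℂ x (π (star a * a) x)
    rw [map_mul, map_star, mul_apply_eq_comp, ContinuousLinearMap.star_eq_adjoint,
      ContinuousLinearMap.adjoint_inner_right]
    rw [inner_self_eq_norm_sq_to_K]
    rw [← RCLike.ofReal_pow]
    exact Complex.zero_le_real.mpr (sq_nonneg ‖π a x‖)
  · change inner ℂ x (π 1 x) = 1
    rw [map_one, one_apply_eq_self, inner_self_eq_norm_sq_to_K, hx]
    simp

namespace DirGraph

variable {V E : Type*} [Fintype V] [Fintype E] {G : DirGraph V E}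

/-- If every vertex receives an edge, every probability vector on the vertices is realised by a
state of the graph algebra. -/
theorem exists_state_p_eq (hG : Function.Surjective G.rng) {m : V → ℝ} (hm : 0 ≤ m)
    (hm1 : ∑ v, m v = 1) :
    ∃ φ : G.CStar →L[ℂ] ℂ, IsCStarState φ ∧ ∀ v, φ (CStar.p G v) = m v := by
  classical
  obtain ⟨θ, hθ⟩ := exists_equiv_fst_eq_rng hG
  let π := CStar.lift (isCuntzKriegerFamily_toCLM θ hθ)
  -- The basis vector at (v, 0) lies in the range of the projection of v, so its vector state is the
  -- point mass at v; convex combinations give every m.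
  have hst : ∀ v : V, ∃ φ : G.CStar →L[ℂ] ℂ, IsCStarState φ ∧
      ∀ w, φ (CStar.p G w) = if v = w then 1 else 0 := fun v => by
    obtain ⟨φ, hφ, h⟩ := exists_vector_state π (lp.single 2 (v, 0) (1 : ℂ))
      (by rw [lp.norm_single (by norm_num)]; simp)
    refine ⟨φ, hφ, fun w => ?_⟩
    rw [h, CStar.lift_p, lp.inner_single_left, PEquiv.toCLM_ofSet_apply]
    by_cases hvw : v = w
    · simp [hvw]
    · simp [hvw]
  choose φ hφ hφp using hst
  refine ⟨∑ v, m v • φ v, (convex_isCStarState G.CStar).sum_mem (fun v _ => hm v) hm1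
    fun v _ => hφ v, fun w => ?_⟩
  simp [sum_apply, smul_apply, hφp]

end DirGraph

/-! ## Relations in Cuntz-Krieger families -/

theorem CStarAlgebra.eq_zero_of_sum_star_mul_self_eq_zero {A ι : Type*} [CStarAlgebra A]
    {s : Finset ι} {x : ι → A} (h : ∑ i ∈ s, star (x i) * x i = 0) {i : ι} (hi : i ∈ s) :
    x i = 0 := by
  let _ := CStarAlgebra.spectralOrder A
  have _ := CStarAlgebra.spectralOrderedRing A
  exact CStarRing.star_mul_self_eq_zero_iff _ |>.mp
    ((Finset.sum_eq_zero_iff_of_nonneg fun i _ => star_mul_self_nonneg (x i)).mp h i hi)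

namespace DirGraph

variable {V E : Type*} [Fintype V] [Fintype E] {G : DirGraph V E}

namespace IsCuntzKriegerFamily

variable {A : Type*} [CStarAlgebra A] {P : V → A} {S : E → A} (h : G.IsCuntzKriegerFamily P S)

include h

theorem S_mul_P_src (e : E) : S e * P (G.src e) = S e := by
  rw [← sub_eq_zero, ← CStarRing.star_mul_self_eq_zero_iff]
  simp only [star_sub, star_mul, sub_mul, mul_sub, h.star_P, ← mul_assoc, h.star_S_mul_S,
    mul_assoc (P _) (star (S e)) (S e), h.P_mul_P_self, sub_self, zero_mul]

theorem P_src_mul_star_S (e : E) : P (G.src e) * star (S e) = star (S e) := by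
  simpa [h.star_P] using congrArg star (h.S_mul_P_src e)

/-- Compressing P_v = ∑ S_f S_f^* by 1 - P_v gives a sum of positive elements equal to zero, so each
S_f^* (1 - P_v) vanishes. -/
theorem P_rng_mul_S (e : E) : P (G.rng e) * S e = S e := by
  classical
  have h0 : ∑ f with G.rng f = G.rng e, star (star (S f) * (1 - P (G.rng e))) *
      (star (S f) * (1 - P (G.rng e))) = 0 := by
    simp only [star_mul, star_sub, star_one, star_star, h.star_P]
    calc _ = (1 - P (G.rng e)) * (∑ f with G.rng f = G.rng e, S f * star (S f)) *
          (1 - P (G.rng e)) := by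
          rw [Finset.mul_sum, Finset.sum_mul]
          exact Finset.sum_congr rfl fun f _ => by simp only [mul_assoc]
      _ = 0 := by rw [← h.P_eq_sum, sub_mul, one_mul, h.P_mul_P_self, sub_self, zero_mul]
  have h1 := CStarAlgebra.eq_zero_of_sum_star_mul_self_eq_zero h0 (i := e) (by simp)
  have h2 := congrArg star h1
  simp only [star_mul, star_sub, star_one, star_star, h.star_P, star_zero, sub_mul, one_mul] at h2
  exact (sub_eq_zero.mp h2).symm

theorem star_S_mul_P_rng (e : E) : star (S e) * P (G.rng e) = star (S e) := by
  simpa [h.star_P] using congrArg star (h.P_rng_mul_S e)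

theorem P_mul_S [DecidableEq V] (v : V) (e : E) :
    P v * S e = if G.rng e = v then S e else 0 := by
  split_ifs with hv
  · rw [← hv, h.P_rng_mul_S]
  · rw [← h.P_rng_mul_S, ← mul_assoc, h.P_mul_P _ _ (Ne.symm hv), zero_mul]

theorem star_S_mul_P [DecidableEq V] (e : E) (v : V) :
    star (S e) * P v = if G.rng e = v then star (S e) else 0 := by
  rw [← h.star_P, ← star_mul, h.P_mul_S]
  split_ifs <;> simp

theorem P_mul_P_eq [DecidableEq V] (v w : V) : P v * P w = if v = w then P v else 0 := by
  split_ifs with hv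
  · rw [← hv, h.P_mul_P_self]
  · exact h.P_mul_P v w hv

/-- For equal ranges, expand the projection in S_e^* P_{r(e)} S_e = P_{s(e)}. The e-term alone
already gives P_{s(e)}, so the other terms, which are positive, sum to zero. For different ranges
the range projections are orthogonal. -/
theorem star_S_mul_S_of_ne {e f : E} (hef : e ≠ f) : star (S f) * S e = 0 := by
  classical
  by_cases hr : G.rng f = G.rng e
  · have h0 : ∑ g ∈ (Finset.univ.filter fun g => G.rng g = G.rng e).erase e,
        star (star (S g) * S e) * (star (S g) * S e) = 0 := by
      have h1 : star (S e) * P (G.rng e) * S e = P (G.src e) := by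
        rw [h.star_S_mul_P_rng, h.star_S_mul_S]
      rw [h.P_eq_sum, ← Finset.add_sum_erase _ _ (a := e) (by simp), mul_add, add_mul,
        Finset.mul_sum, Finset.sum_mul, ← mul_assoc, h.star_S_mul_S, h.P_src_mul_star_S,
        h.star_S_mul_S] at h1
      simpa [mul_assoc] using h1
    exact CStarAlgebra.eq_zero_of_sum_star_mul_self_eq_zero h0 (i := f) (by simp [hef.symm, hr])
  · rw [← h.P_rng_mul_S e, ← h.star_S_mul_P_rng f, mul_assoc, ← mul_assoc (P _),
      h.P_mul_P _ _ hr, zero_mul, mul_zero]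

theorem star_S_mul_S_eq [DecidableEq E] (e f : E) :
    star (S f) * S e = if e = f then P (G.src e) else 0 := by
  split_ifs with hef
  · rw [hef, h.star_S_mul_S]
  · exact h.star_S_mul_S_of_ne hef

end IsCuntzKriegerFamily

/-! ### The gauge grading and the KMS condition on homogeneous elements -/

namespace CStar

/-- Elements of degree `k` for the gauge grading. -/
def IsHomogeneous (k : ℤ) (a : G.CStar) : Prop :=
  ∀ t : ℝ, dynamics G t a = Complex.exp (k * t * Complex.I) • a

namespace IsHomogeneous

theorem p (v : V) : IsHomogeneous 0 (p G v) := fun t => by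
  simpa [dynamics] using gauge_p (Circle.exp t) v

theorem s (e : E) : IsHomogeneous 1 (s G e) := fun t => by
  simpa [dynamics] using gauge_s (Circle.exp t) e

theorem one : IsHomogeneous 0 (1 : G.CStar) := fun t => by simp

theorem mul {k l : ℤ} {a b : G.CStar} (ha : IsHomogeneous k a) (hb : IsHomogeneous l b) :
    IsHomogeneous (k + l) (a * b) := fun t => by
  rw [map_mul, ha t, hb t, smul_mul_smul_comm, ← Complex.exp_add]
  push_cast
  ring_nf

theorem star {k : ℤ} {a : G.CStar} (ha : IsHomogeneous k a) :
    IsHomogeneous (-k) (star a) := fun t => by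
  rw [map_star, ha t, star_smul, Complex.star_def, ← Complex.exp_conj]
  simp

theorem isEntireOrbit {k : ℤ} {a : G.CStar} (ha : IsHomogeneous k a) :
    IsEntireOrbit (dynamics G) a fun z => Complex.exp (k * z * Complex.I) • a where
  differentiable := by fun_prop
  eq_orbit t := (ha t).symm

/-- The KMS condition for homogeneous elements. -/
theorem kms {k l : ℤ} {a b : G.CStar} (ha : IsHomogeneous k a) (hb : IsHomogeneous l b)
    {β : ℝ} {φ : G.CStar →L[ℂ] ℂ} (hφ : IsKMSState (dynamics G) β φ) :
    φ (a * b) = Complex.exp (-(k * β)) * φ (b * a) := by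
  rw [hφ.kms a b _ _ ha.isEntireOrbit hb.isEntireOrbit, mul_smul_comm, map_smul, smul_eq_mul]
  congr 2
  linear_combination (k * β : ℂ) * Complex.I_mul_I

/-- For β ≠ 0, the KMS condition against 1 gives φ(a) = e^{-kβ} φ(a). For β = 0 this is vacuous, and
invariance at time π/k, which sends `a` to `-a`, replaces it. -/
theorem apply_eq_zero {k : ℤ} {a : G.CStar} (ha : IsHomogeneous k a) (hk : k ≠ 0)
    {β : ℝ} {φ : G.CStar →L[ℂ] ℂ} (hφ : IsKMSState (dynamics G) β φ) : φ a = 0 := by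
  by_cases hβ : β = 0
  · have h1 := hφ.invariant hβ (Real.pi / k) a
    have hk' : (k : ℂ) ≠ 0 := by exact_mod_cast hk
    have h2 : Complex.exp (k * (Real.pi / k : ℝ) * Complex.I) = -1 := by
      rw [← Complex.exp_pi_mul_I]
      push_cast
      rw [mul_div_cancel₀ _ hk']
    rw [ha, h2, map_smul, smul_eq_mul] at h1
    linear_combination -(1 / 2 : ℂ) * h1
  · have h1 := ha.kms one hφ
    rw [mul_one, one_mul] at h1
    have h2 : Complex.exp (-(k * β)) ≠ 1 := by
      intro h
      have h3 : Real.exp (-(k * β)) = 1 := by exact_mod_cast h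
      rw [Real.exp_eq_one_iff] at h3
      simp [hk, hβ] at h3
    have h3 : (Complex.exp (-(k * β)) - 1) * φ a = 0 := by linear_combination -h1
    exact (mul_eq_zero.mp h3).resolve_left (sub_ne_zero.mpr h2)

end IsHomogeneous

/-! ### The spanning monomials -/

variable (G) in
/-- The element `s_μ p_v s_ν^*`. -/
def monomial (μ : List E) (v : V) (ν : List E) : G.CStar :=
  (μ.map (s G)).prod * p G v * star (ν.map (s G)).prod

theorem isHomogeneous_prod (μ : List E) : IsHomogeneous μ.length (μ.map (s G)).prod := by
  induction μ with
  | nil => exact IsHomogeneous.one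
  | cons e μ ih =>
    have := (IsHomogeneous.s (G := G) e).mul ih
    simpa [add_comm] using this

theorem isHomogeneous_monomial (μ : List E) (v : V) (ν : List E) :
    IsHomogeneous (μ.length - ν.length) (monomial G μ v ν) := by
  have := ((isHomogeneous_prod (G := G) μ).mul (.p v)).mul (isHomogeneous_prod ν).star
  simpa [sub_eq_add_neg] using! this

theorem monomial_cons_cons (e f : E) (μ ν : List E) (v : V) :
    monomial G (e :: μ) v (f :: ν) = s G e * (monomial G μ v ν * star (s G f)) := by
  simp [monomial, mul_assoc]

theorem s_mul_monomial (e : E) (μ : List E) (v : V) (ν : List E) :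
    s G e * monomial G μ v ν = monomial G (e :: μ) v ν := by
  simp [monomial, mul_assoc]

theorem p_mul_monomial (w : V) (μ : List E) (v : V) (ν : List E) :
    p G w * monomial G μ v ν = monomial G μ v ν ∨ p G w * monomial G μ v ν = 0 := by
  classical
  have h := isCuntzKriegerFamily (G := G)
  cases μ with
  | nil =>
    simp only [monomial, List.map_nil, List.prod_nil, one_mul, ← mul_assoc, h.P_mul_P_eq]
    split_ifs with hw
    · exact .inl (by rw [hw])
    · exact .inr (by simp)
  | cons e μ =>
    simp only [monomial, List.map_cons, List.prod_cons, ← mul_assoc, h.P_mul_S]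
    split_ifs
    · exact .inl rfl
    · exact .inr (by simp)

theorem star_monomial (μ : List E) (v : V) (ν : List E) :
    star (monomial G μ v ν) = monomial G ν v μ := by
  simp [monomial, mul_assoc, (isCuntzKriegerFamily (G := G)).star_P]

theorem monomial_mul_p (w : V) (μ : List E) (v : V) (ν : List E) :
    monomial G μ v ν * p G w = monomial G μ v ν ∨ monomial G μ v ν * p G w = 0 := by
  have h := p_mul_monomial (G := G) w ν v μ
  rw [← star_monomial μ v ν, ← (isCuntzKriegerFamily (G := G)).star_P w, ← star_mul,
    star_inj, star_eq_zero] at h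
  exact h

variable (G) in
/-- The span of the monomials `s_μ p_v s_ν^*`. -/
def monomialSpan : Submodule ℂ G.CStar :=
  Submodule.span ℂ (Set.range fun q : List E × V × List E => monomial G q.1 q.2.1 q.2.2)

theorem monomial_mem (μ : List E) (v : V) (ν : List E) : monomial G μ v ν ∈ monomialSpan G :=
  Submodule.subset_span ⟨(μ, v, ν), rfl⟩

theorem p_mul_monomial_mem (w : V) (μ : List E) (v : V) (ν : List E) :
    p G w * monomial G μ v ν ∈ monomialSpan G := by
  rcases p_mul_monomial (G := G) w μ v ν with h | h <;> rw [h]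
  · exact monomial_mem μ v ν
  · exact zero_mem _

theorem star_s_mul_monomial_mem (e : E) (μ : List E) (v : V) (ν : List E) :
    star (s G e) * monomial G μ v ν ∈ monomialSpan G := by
  classical
  have h := isCuntzKriegerFamily (G := G)
  cases μ with
  | nil =>
    -- The new adjoint stands to the left of s_ν^*, so the letter `e` is appended at the end of ν.
    have h1 : star (s G e) * monomial G [] v ν =
        if G.rng e = v then monomial G [] (G.src e) (ν ++ [e]) else 0 := by
      simp only [monomial, List.map_nil, List.prod_nil, one_mul, ← mul_assoc, h.star_S_mul_P,
        List.map_append, List.map_cons, List.prod_append, List.prod_cons, mul_one, star_mul,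
        h.P_src_mul_star_S]
      split_ifs <;> simp
    rw [h1]
    split_ifs
    · exact monomial_mem _ _ _
    · exact zero_mem _
  | cons f μ =>
    rw [← s_mul_monomial, ← mul_assoc, h.star_S_mul_S_eq]
    split_ifs
    · exact p_mul_monomial_mem _ _ _ _
    · rw [zero_mul]; exact zero_mem _

theorem letter_mul_mem (x : StarLetter (V ⊕ E)) {y : G.CStar} (hy : y ∈ monomialSpan G) :
    mk (FreeStarAlg.letter x) * y ∈ monomialSpan G := by
  have hstar : ∀ z : V ⊕ E, (mk (FreeStarAlg.letter (Sum.inr z)) : G.CStar)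
      = star (mk (FreeStarAlg.gen z)) := fun z => by
    rw [star_mk, FreeStarAlg.gen, FreeStarAlg.star_letter, Sum.swap_inl]
  induction hy using Submodule.span_induction with
  | zero => rw [mul_zero]; exact zero_mem _
  | add a b _ _ ha hb => rw [mul_add]; exact add_mem ha hb
  | smul c a _ ha => rw [mul_smul_comm]; exact Submodule.smul_mem _ c ha
  | mem a ha =>
    obtain ⟨⟨μ, v, ν⟩, rfl⟩ := ha
    rcases x with (w | e) | (w | e)
    · exact p_mul_monomial_mem w μ v ν
    · exact (s_mul_monomial (G := G) e μ v ν) ▸ monomial_mem (e :: μ) v ν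
    · rw [hstar]
      exact ((isCuntzKriegerFamily (G := G)).star_P w).symm ▸ p_mul_monomial_mem w μ v ν
    · rw [hstar]
      exact star_s_mul_monomial_mem e μ v ν

/-- The span contains 1 = ∑ p_v and is stable under left multiplication by every letter, so it
contains every star polynomial in the generators. -/
theorem mk_mem_monomialSpan (a : FreeStarAlg (V ⊕ E)) : (mk a : G.CStar) ∈ monomialSpan G := by
  have h1 : (1 : G.CStar) ∈ monomialSpan G := by
    rw [← (isCuntzKriegerFamily (G := G)).sum_P]
    refine sum_mem fun v _ => ?_
    simpa [monomial] using monomial_mem (G := G) [] v []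
  have key : ∀ y ∈ monomialSpan G, (mk a : G.CStar) * y ∈ monomialSpan G := by
    induction a using FreeStarAlg.induction with
    | scalar c =>
      intro y hy
      rw [AlgHomClass.commutes, ← Algebra.smul_def]
      exact Submodule.smul_mem _ c hy
    | letter x => exact fun y hy => letter_mul_mem x hy
    | add a b ha hb =>
      intro y hy
      rw [map_add, add_mul]
      exact add_mem (ha y hy) (hb y hy)
    | mul a b ha hb =>
      intro y hy
      rw [map_mul, mul_assoc]
      exact ha _ (hb y hy)
  simpa using key 1 h1

end CStar

/-! ### Uniqueness of KMS states -/

namespace CStar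

variable {β : ℝ} {φ : G.CStar →L[ℂ] ℂ}

theorem isKMSState_apply_p (hφ : IsKMSState (dynamics G) β φ) (v : V) :
    0 ≤ (φ (p G v)).re ∧ φ (p G v) = ((φ (p G v)).re : ℂ) := by
  have h := isCuntzKriegerFamily (G := G)
  have h1 := hφ.isState.nonneg (p G v)
  rw [h.star_P, h.P_mul_P_self] at h1
  rw [Complex.nonneg_iff] at h1
  exact ⟨h1.1, Complex.ext rfl h1.2.symm⟩

theorem sum_isKMSState_apply_p (hφ : IsKMSState (dynamics G) β φ) :
    ∑ v, (φ (p G v)).re = 1 := by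
  rw [← Complex.re_sum, ← map_sum, (isCuntzKriegerFamily (G := G)).sum_P, hφ.isState.map_one,
    Complex.one_re]

/-- The values of a KMS state on the vertex projections form an eigenvector. -/
theorem edgeOp_isKMSState (hφ : IsKMSState (dynamics G) β φ) :
    G.edgeOp (fun v => (φ (p G v)).re) = Real.exp β • fun v => (φ (p G v)).re := by
  classical
  have h := isCuntzKriegerFamily (G := G)
  ext v
  have h1 : φ (p G v) = ∑ e with G.rng e = v, Complex.exp (-β) * φ (p G (G.src e)) := by
    rw [h.P_eq_sum, map_sum]
    refine Finset.sum_congr rfl fun e _ => ?_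
    have h2 := (IsHomogeneous.s (G := G) e).kms (IsHomogeneous.s e).star hφ
    rwa [h.star_S_mul_S, Int.cast_one, one_mul] at h2
  have h3 := congrArg Complex.re h1
  rw [← Finset.mul_sum, ← Complex.ofReal_neg, ← Complex.ofReal_exp, Complex.re_ofReal_mul,
    Complex.re_sum] at h3
  rw [edgeOp_apply, Pi.smul_apply, smul_eq_mul, h3, ← mul_assoc, ← Real.exp_add]
  simp

/-- The vertex values are a nonzero nonnegative eigenvector for e^β, hence strictly positive, and
only the spectral radius has such an eigenvector. -/
theorem exp_eq_rho_of_isKMSState [Nonempty E] (hG : G.IsStronglyConnected)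
    (hφ : IsKMSState (dynamics G) β φ) : Real.exp β = G.rho := by
  have : Nonempty V := ‹Nonempty E›.map G.rng
  refine (rho_eq_of_eigenvector (Real.exp_pos β) (edgeOp_isKMSState hφ)
    (hG.eigenvector_pos (edgeOp_isKMSState hφ) (fun v => (isKMSState_apply_p hφ v).1) ?_)).symm
  intro h0
  have := sum_isKMSState_apply_p hφ
  simp only [funext_iff, Pi.zero_apply] at h0
  simp [h0] at this

/-- A KMS state is determined by its values on the vertex projections. -/
theorem isKMSState_ext {ψ : G.CStar →L[ℂ] ℂ} (hφ : IsKMSState (dynamics G) β φ)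
    (hψ : IsKMSState (dynamics G) β ψ) (hp : ∀ v, φ (p G v) = ψ (p G v)) : φ = ψ := by
  classical
  have h := isCuntzKriegerFamily (G := G)
  -- If exactly one word is empty, the degree is nonzero and both states vanish. If both are
  -- nonempty, moving s_e to the right produces s_f^* s_e, which is p_{s(e)} or 0, and leaves
  -- shorter words.
  have hmon : ∀ (μ : List E) (v : V) (ν : List E),
      φ (monomial G μ v ν) = ψ (monomial G μ v ν) := by
    intro μ v
    induction μ with
    | nil =>
      intro ν
      cases ν with
      | nil => simpa [monomial] using hp v
      | cons f ν =>
        have hh := isHomogeneous_monomial (G := G) [] v (f :: ν)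
        have hk : ((([] : List E).length : ℤ) - ((f :: ν).length : ℤ)) ≠ 0 := by simp; omega
        rw [hh.apply_eq_zero hk hφ, hh.apply_eq_zero hk hψ]
    | cons e μ ih =>
      intro ν
      cases ν with
      | nil =>
        have hh := isHomogeneous_monomial (G := G) (e :: μ) v []
        have hk : (((e :: μ).length : ℤ) - (([] : List E).length : ℤ)) ≠ 0 := by simp; omega
        rw [hh.apply_eq_zero hk hφ, hh.apply_eq_zero hk hψ]
      | cons f ν =>
        have hb := (isHomogeneous_monomial (G := G) μ v ν).mul (IsHomogeneous.s f).star
        rw [monomial_cons_cons, (IsHomogeneous.s e).kms hb hφ, (IsHomogeneous.s e).kms hb hψ]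
        congr 1
        rw [mul_assoc, h.star_S_mul_S_eq]
        split_ifs
        · rcases monomial_mul_p (G := G) (G.src e) μ v ν with h1 | h1 <;> rw [h1]
          · exact ih ν
          · simp
        · simp
  have hspan : ∀ y ∈ monomialSpan G, φ y = ψ y := fun y hy => by
    induction hy using Submodule.span_induction with
    | zero => simp
    | add a b _ _ ha hb => rw [map_add, map_add, ha, hb]
    | smul c a _ ha => rw [map_smul, map_smul, ha]
    | mem a ha => obtain ⟨q, rfl⟩ := ha; exact hmon _ _ _
  exact DFunLike.coe_injective (denseRange_mk.equalizer φ.continuous ψ.continuous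
    (funext fun a => hspan _ (mk_mem_monomialSpan a)))

theorem isKMSState_unique [Nonempty E] (hG : G.IsStronglyConnected) {β₁ β₂ : ℝ}
    {φ ψ : G.CStar →L[ℂ] ℂ} (hφ : IsKMSState (dynamics G) β₁ φ)
    (hψ : IsKMSState (dynamics G) β₂ ψ) : φ = ψ := by
  have hβ : β₁ = β₂ := Real.exp_injective
    ((exp_eq_rho_of_isKMSState hG hφ).trans (exp_eq_rho_of_isKMSState hG hψ).symm)
  subst hβ
  refine isKMSState_ext hφ hψ fun v => ?_
  rw [(isKMSState_apply_p hφ v).2, (isKMSState_apply_p hψ v).2]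
  exact congrArg _ (congrFun (hG.eigenvector_unique (edgeOp_isKMSState hφ) (edgeOp_isKMSState hψ)
    (fun v => (isKMSState_apply_p hφ v).1) (fun v => (isKMSState_apply_p hψ v).1)
    (sum_isKMSState_apply_p hφ) (sum_isKMSState_apply_p hψ)) v)

end CStar

end DirGraph

/-! ### Existence of a KMS state -/

namespace DirGraph

variable {V E : Type*} [Fintype V] [Fintype E] {G : DirGraph V E}

namespace CStar

variable (G) in
/-- The dynamics as continuous linear maps. -/
def dynamicsCLM (t : ℝ) : G.CStar →L[ℂ] G.CStar :=
  (dynamics G t : G.CStar →ₗ[ℂ] G.CStar).mkContinuous 1 fun a => by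
    rw [one_mul]
    exact NonUnitalStarAlgHom.norm_apply_le (dynamics G t) a

theorem dynamicsCLM_apply (t : ℝ) (a : G.CStar) : dynamicsCLM G t a = dynamics G t a := rfl

variable (G) in
/-- The transfer operator `a ↦ c ∑ s_e^* a s_e`. -/
def transfer (c : ℝ) : G.CStar →L[ℂ] G.CStar :=
  (c : ℂ) • ∑ e, (ContinuousLinearMap.mul ℂ G.CStar (star (s G e))).comp
    ((ContinuousLinearMap.mul ℂ G.CStar).flip (s G e))

theorem transfer_apply (c : ℝ) (a : G.CStar) :
    transfer G c a = (c : ℂ) • ∑ e, star (s G e) * (a * s G e) := by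
  simp [transfer, sum_apply, smul_apply]

/-- In s_e^* p_v a s_e the projection only selects the edges with range v, and it does the same in
s_e^* a p_v s_e. -/
theorem transfer_p_mul (c : ℝ) (v : V) (a : G.CStar) :
    transfer G c (p G v * a) = transfer G c (a * p G v) := by
  classical
  have h := isCuntzKriegerFamily (G := G)
  simp only [transfer_apply]
  congr 1
  refine Finset.sum_congr rfl fun e _ => ?_
  rw [mul_assoc a, h.P_mul_S, mul_assoc (p G v), ← mul_assoc (star (s G e)) (p G v),
    h.star_S_mul_P]
  split_ifs <;> simp

theorem transfer_s_mul (c : ℝ) (e : E) (a : G.CStar) :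
    transfer G c (s G e * a) = (c : ℂ) • (p G (G.src e) * (a * s G e)) := by
  classical
  have h := isCuntzKriegerFamily (G := G)
  simp only [transfer_apply, mul_assoc (s G e), ← mul_assoc (star (s G _)) (s G e),
    h.star_S_mul_S_eq, ite_mul, zero_mul, Finset.sum_ite_eq, Finset.mem_univ, if_true]

theorem transfer_mul_star_s (c : ℝ) (e : E) (a : G.CStar) :
    transfer G c (a * star (s G e)) = (c : ℂ) • (star (s G e) * (a * p G (G.src e))) := by
  classical
  have h := isCuntzKriegerFamily (G := G)
  simp only [transfer_apply, mul_assoc a, h.star_S_mul_S_eq, mul_ite, mul_zero,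
    Finset.sum_ite_eq', Finset.mem_univ, if_true]

theorem transfer_dynamics (c t : ℝ) (a : G.CStar) :
    transfer G c (dynamics G t a) = dynamics G t (transfer G c a) := by
  simp only [transfer_apply, map_smul, map_sum, map_mul, (IsHomogeneous.s _).star t,
    IsHomogeneous.s _ t, smul_mul_assoc, mul_smul_comm, smul_smul, ← Complex.exp_add]
  congr 1
  refine Finset.sum_congr rfl fun e _ => ?_
  simp

/-! ### States fixed by the transfer operator -/

section Fixed

variable {m : V → ℝ} {c : ℝ} {φ : G.CStar →L[ℂ] ℂ}

theorem apply_transfer_p (hm : G.edgeOp m = c⁻¹ • m) (hc : 0 < c)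
    (hφ : ∀ v, φ (p G v) = m v) (v : V) : φ (transfer G c (p G v)) = m v := by
  classical
  have h := isCuntzKriegerFamily (G := G)
  have h1 : ∀ e, φ (star (s G e) * (p G v * s G e))
      = if G.rng e = v then (m (G.src e) : ℂ) else 0 := fun e => by
    rw [h.P_mul_S]
    split_ifs
    · rw [h.star_S_mul_S, hφ]
    · simp
  have h2 := congrFun hm v
  rw [edgeOp_apply, Pi.smul_apply, smul_eq_mul] at h2
  rw [transfer_apply, map_smul, map_sum]
  simp only [h1]
  rw [← Finset.sum_filter, ← Complex.ofReal_sum, h2, smul_eq_mul, ← Complex.ofReal_mul,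
    mul_inv_cancel_left₀ hc.ne']

/-- Positivity is s_e^* a^* a s_e = (a s_e)^* (a s_e). The value at 1 is preserved because 1 = ∑ p_v
and the eigenvector equation preserves each φ(p_v). -/
theorem isCStarState_comp_transfer (hm : G.edgeOp m = c⁻¹ • m) (hc : 0 < c)
    (hm1 : ∑ v, m v = 1) (hφ : ∀ v, φ (p G v) = m v) (hst : IsCStarState φ) :
    IsCStarState (φ.comp (transfer G c)) where
  nonneg a := by
    rw [ContinuousLinearMap.comp_apply, transfer_apply, map_smul, map_sum, smul_eq_mul]
    refine mul_nonneg (Complex.zero_le_real.mpr hc.le) (Finset.sum_nonneg fun e _ => ?_)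
    have := hst.nonneg (a * s G e)
    rwa [star_mul, mul_assoc, ← mul_assoc (star a)] at this
  map_one := by
    rw [← (isCuntzKriegerFamily (G := G)).sum_P, map_sum]
    simp only [ContinuousLinearMap.comp_apply, apply_transfer_p hm hc hφ]
    exact_mod_cast hm1

theorem isCStarState_comp_dynamics (t : ℝ) (hst : IsCStarState φ) :
    IsCStarState (φ.comp (dynamicsCLM G t)) where
  nonneg a := by
    rw [ContinuousLinearMap.comp_apply, dynamicsCLM_apply, map_mul, map_star]
    exact hst.nonneg _
  map_one := by
    rw [ContinuousLinearMap.comp_apply, dynamicsCLM_apply, map_one, hst.map_one]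

/-- A state which is fixed by the transfer operator and by the dynamics at time `1`. -/
theorem exists_state_fixed (hG : Function.Surjective G.rng) (hm0 : 0 ≤ m)
    (hm : G.edgeOp m = c⁻¹ • m) (hc : 0 < c) (hm1 : ∑ v, m v = 1) :
    ∃ φ : G.CStar →L[ℂ] ℂ, IsCStarState φ ∧ (∀ a, φ (transfer G c a) = φ a) ∧
      ∀ a, φ (dynamics G 1 a) = φ a := by
  let K : Set (G.CStar →L[ℂ] ℂ) := {φ | IsCStarState φ ∧ ∀ v, φ (p G v) = m v}
  have hK : Convex ℝ K := by
    refine (convex_isCStarState G.CStar).inter ?_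
    intro φ hφ ψ hψ s t _ _ hst v
    have h1 := hφ v
    have h2 := hψ v
    simp only [add_apply, smul_apply, h1, h2, ← add_smul, hst, one_smul]
  have hlim : ∀ (ψ : ℕ → G.CStar →L[ℂ] ℂ) (φ : G.CStar →L[ℂ] ℂ) (F : Ultrafilter ℕ),
      (∀ n, ψ n ∈ K) → (∀ a, Filter.Tendsto (fun n => ψ n a) F (nhds (φ a))) → φ ∈ K :=
    fun ψ φ F hψ h => ⟨.of_tendsto (fun n => (hψ n).1) h, fun v =>
      tendsto_nhds_unique (h _) (tendsto_const_nhds.congr fun n => ((hψ n).2 v).symm)⟩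
  obtain ⟨φ₁, hφ₁K, hφ₁⟩ := exists_comp_eq_self_of_convex K (exists_state_p_eq hG hm0 hm1) hK 4
    (by norm_num) (fun φ hφ => hφ.1.norm_apply_le) hlim (dynamicsCLM G 1) fun φ hφ =>
      ⟨isCStarState_comp_dynamics 1 hφ.1, fun v => by
        rw [ContinuousLinearMap.comp_apply, dynamicsCLM_apply, IsHomogeneous.p v 1, map_smul,
          hφ.2]
        simp⟩
  -- The transfer operator commutes with the dynamics, so it preserves the states already made
  -- invariant at time 1; the second averaging keeps that invariance.
  let K' : Set (G.CStar →L[ℂ] ℂ) := K ∩ {φ | ∀ a, φ (dynamics G 1 a) = φ a}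
  have hK' : Convex ℝ K' := by
    refine hK.inter ?_
    intro φ hφ ψ hψ s t _ _ _ a
    simp only [add_apply, smul_apply, hφ a, hψ a]
  obtain ⟨φ, hφK, hφ⟩ := exists_comp_eq_self_of_convex K'
    ⟨φ₁, hφ₁K, fun a => DFunLike.congr_fun hφ₁ a⟩ hK' 4
    (by norm_num) (fun φ hφ => hφ.1.1.norm_apply_le)
    (fun ψ φ F hψ h => ⟨hlim ψ φ F (fun n => (hψ n).1) h, fun a =>
      tendsto_nhds_unique (h _) ((h a).congr fun n => ((hψ n).2 a).symm)⟩)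
    (transfer G c) fun φ hφ =>
      ⟨⟨isCStarState_comp_transfer hm hc hm1 hφ.1.2 hφ.1.1, apply_transfer_p hm hc hφ.1.2⟩,
        fun a => by
          rw [ContinuousLinearMap.comp_apply, transfer_dynamics, hφ.2]
          rfl⟩
  exact ⟨φ, hφK.1.1, fun a => DFunLike.congr_fun hφ a, hφK.2⟩

variable (hT : ∀ a, φ (transfer G c a) = φ a)

include hT

theorem apply_p_mul (v : V) (a : G.CStar) : φ (p G v * a) = φ (a * p G v) := by
  rw [← hT, transfer_p_mul, hT]

/-- Insert T: orthogonality s_f^* s_e = 0 for f ≠ e leaves c φ(p_{s(e)} a s_e), and moving the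
projection to the right absorbs it into s_e. -/
theorem apply_s_mul (e : E) (a : G.CStar) : φ (s G e * a) = c * φ (a * s G e) := by
  rw [← hT, transfer_s_mul, map_smul, apply_p_mul hT, mul_assoc,
    (isCuntzKriegerFamily (G := G)).S_mul_P_src, smul_eq_mul]

theorem apply_mul_star_s (e : E) (a : G.CStar) :
    φ (a * star (s G e)) = c * φ (star (s G e) * a) := by
  rw [← hT, transfer_mul_star_s, map_smul, ← mul_assoc, ← apply_p_mul hT, ← mul_assoc,
    (isCuntzKriegerFamily (G := G)).P_src_mul_star_S, smul_eq_mul]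

/-- Words in the generators are homogeneous and satisfy the twisted trace identity. -/
theorem exists_isHomogeneous_word (hc : c ≠ 0) (w : FreeMonoid (StarLetter (V ⊕ E))) :
    ∃ k : ℤ, IsHomogeneous k (mk (MonoidAlgebra.of ℂ _ w) : G.CStar) ∧
      ∀ a, φ (mk (MonoidAlgebra.of ℂ _ w) * a) = (c : ℂ) ^ k * φ (a * mk (MonoidAlgebra.of ℂ _ w))
    := by
  have hc' : (c : ℂ) ≠ 0 := by exact_mod_cast hc
  have hstar : ∀ z : V ⊕ E, (mk (FreeStarAlg.letter (Sum.inr z)) : G.CStar)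
      = star (mk (FreeStarAlg.gen z)) := fun z => by
    rw [star_mk, FreeStarAlg.gen, FreeStarAlg.star_letter, Sum.swap_inl]
  induction w using FreeMonoid.inductionOn' with
  | one => exact ⟨0, by rw [map_one, map_one]; exact .one, fun a => by
      rw [map_one, map_one]; simp⟩
  | of_mul x w ih =>
    obtain ⟨k, hk, hkφ⟩ := ih
    have hx : ∃ l : ℤ, IsHomogeneous l (mk (FreeStarAlg.letter x) : G.CStar) ∧
        ∀ a, φ (mk (FreeStarAlg.letter x) * a)
          = (c : ℂ) ^ l * φ (a * mk (FreeStarAlg.letter x)) := by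
      rcases x with (v | e) | (v | e)
      · exact ⟨0, .p v, fun a => by simpa using! apply_p_mul hT v a⟩
      · exact ⟨1, .s e, fun a => by simpa using! apply_s_mul hT e a⟩
      · rw [hstar]
        change ∃ l : ℤ, IsHomogeneous l (star (p G v)) ∧
          ∀ a, φ (star (p G v) * a) = (c : ℂ) ^ l * φ (a * star (p G v))
        rw [(isCuntzKriegerFamily (G := G)).star_P]
        exact ⟨0, .p v, fun a => by simpa using! apply_p_mul hT v a⟩
      · rw [hstar]
        change ∃ l : ℤ, IsHomogeneous l (star (s G e)) ∧
          ∀ a, φ (star (s G e) * a) = (c : ℂ) ^ l * φ (a * star (s G e))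
        refine ⟨-1, (IsHomogeneous.s e).star, fun a => ?_⟩
        rw [apply_mul_star_s hT, zpow_neg_one, inv_mul_cancel_left₀ hc']
    obtain ⟨l, hl, hlφ⟩ := hx
    have hmul : (mk (MonoidAlgebra.of ℂ _ (FreeMonoid.of x * w)) : G.CStar)
        = mk (FreeStarAlg.letter x) * mk (MonoidAlgebra.of ℂ _ w) := by
      rw [map_mul, map_mul]; rfl
    refine ⟨l + k, hmul ▸ hl.mul hk, fun a => ?_⟩
    rw [hmul, mul_assoc, hlφ, mul_assoc, hkφ, zpow_add₀ hc', mul_assoc, mul_assoc]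

end Fixed

/-- Two continuous linear maps on the graph algebra agree if they agree on words. -/
theorem continuousLinearMap_ext {φ ψ : G.CStar →L[ℂ] ℂ}
    (h : ∀ w, φ (mk (MonoidAlgebra.of ℂ _ w)) = ψ (mk (MonoidAlgebra.of ℂ _ w))) : φ = ψ := by
  refine DFunLike.coe_injective (denseRange_mk.equalizer φ.continuous ψ.continuous
    (funext fun a => ?_))
  simp only [Function.comp_apply]
  induction a using MonoidAlgebra.induction_on with
  | of w => exact h w
  | add a b ha hb => rw [map_add, map_add, map_add, ha, hb]
  | smul c a ha => rw [map_smul, map_smul, map_smul, ha]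

/-- Otherwise k would be a nonzero integer multiple of 2π, making π rational. This is why the single
time 1 detects every nonzero degree. -/
theorem exp_int_mul_I_ne_one {k : ℤ} (hk : k ≠ 0) : Complex.exp (k * (1 : ℝ) * Complex.I) ≠ 1 := by
  rw [Ne, Complex.exp_eq_one_iff]
  rintro ⟨n, hn⟩
  have h1 : (k : ℝ) = n * (2 * Real.pi) := by
    have := congrArg Complex.im hn
    simpa using this
  have hn0 : n ≠ 0 := by
    rintro rfl
    simp at h1
    exact hk h1
  have hn' : (n : ℝ) ≠ 0 := by exact_mod_cast hn0
  refine irrational_pi ⟨k / (2 * n), ?_⟩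
  push_cast
  rw [h1]
  field_simp

/-- States fixed by the transfer operator and by the dynamics at time `1` are KMS states. -/
theorem isKMSState_of_fixed {β : ℝ} {φ : G.CStar →L[ℂ] ℂ} (hst : IsCStarState φ)
    (hT : ∀ a, φ (transfer G (Real.exp (-β)) a) = φ a)
    (h1 : ∀ a, φ (dynamics G 1 a) = φ a) : IsKMSState (dynamics G) β φ := by
  have hword := exists_isHomogeneous_word hT (Real.exp_ne_zero _)
  have hinv : ∀ t a, φ (dynamics G t a) = φ a := fun t a => by
    have : φ.comp (dynamicsCLM G t) = φ := by
      refine continuousLinearMap_ext fun w => ?_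
      obtain ⟨k, hk, -⟩ := hword w
      rw [ContinuousLinearMap.comp_apply, dynamicsCLM_apply]
      by_cases hk0 : k = 0
      · rw [hk t, hk0]; simp
      · have h2 := h1 (mk (MonoidAlgebra.of ℂ _ w))
        rw [hk 1, map_smul, smul_eq_mul] at h2
        have h3 : (Complex.exp (k * (1 : ℝ) * Complex.I) - 1) *
            φ (mk (MonoidAlgebra.of ℂ _ w)) = 0 := by linear_combination h2
        have h4 := (mul_eq_zero.mp h3).resolve_left (sub_ne_zero.mpr (exp_int_mul_I_ne_one hk0))
        rw [hk t, map_smul, h4, smul_zero]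
    exact DFunLike.congr_fun this a
  refine ⟨hst, fun a b f _ hf _ => ?_, fun _ => hinv⟩
  -- With `a` and its orbit fixed, both sides of the KMS identity are continuous and linear in `b`,
  -- so it suffices to take for `b` a word of some degree k.
  have key : φ.comp (ContinuousLinearMap.mul ℂ G.CStar a)
      = φ.comp ((ContinuousLinearMap.mul ℂ G.CStar).flip (f (Complex.I * β))) := by
    refine continuousLinearMap_ext fun w => ?_
    obtain ⟨k, hk, hkφ⟩ := hword w
    set b := (mk (MonoidAlgebra.of ℂ _ w) : G.CStar)
    change φ (a * b) = φ (b * f (Complex.I * β))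
    have hF : Differentiable ℂ fun z => φ (b * f z) :=
      (φ.differentiable.comp ((ContinuousLinearMap.mul ℂ G.CStar b).differentiable)).comp
        hf.differentiable
    have hH : Differentiable ℂ fun z => Complex.exp (-(k * z * Complex.I)) * φ (b * a) := by
      fun_prop
    have hreal : ∀ t : ℝ, φ (b * f t) = Complex.exp (-(k * t * Complex.I)) * φ (b * a) := by
      intro t
      have h2 := hinv t (b * a)
      rw [map_mul, hk t, smul_mul_assoc, map_smul, smul_eq_mul] at h2
      rw [hf.eq_orbit, ← h2, ← mul_assoc, ← Complex.exp_add, neg_add_cancel, Complex.exp_zero,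
        one_mul]
    -- Invariance proves equality on the real line; the points 1/(n+1) accumulate at 0, so the
    -- identity theorem extends it to z = iβ. There the exponential is e^{kβ}, which cancels the
    -- factor c^k = e^{-kβ} from the twisted trace identity.
    have heq : (fun z => φ (b * f z)) = fun z => Complex.exp (-(k * z * Complex.I)) * φ (b * a) := by
      refine AnalyticOnNhd.eq_of_frequently_eq (z₀ := 0)
        (fun z _ => hF.analyticAt z) (fun z _ => hH.analyticAt z) ?_
      have hseq : Filter.Tendsto (fun n : ℕ => (((1 / ((n : ℝ) + 1) : ℝ)) : ℂ)) Filter.atTop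
          (nhdsWithin 0 {0}ᶜ) := by
        refine tendsto_nhdsWithin_iff.mpr ⟨?_, .of_forall fun n => ?_⟩
        · have h0 : Filter.Tendsto (fun n : ℕ => (((1 / ((n : ℝ) + 1) : ℝ)) : ℂ)) Filter.atTop
              (nhds ((0 : ℝ) : ℂ)) := (Complex.continuous_ofReal.tendsto 0).comp
            (tendsto_one_div_add_atTop_nhds_zero_nat (𝕜 := ℝ))
          rwa [Complex.ofReal_zero] at h0
        · simp only [Set.mem_compl_iff, Set.mem_singleton_iff, Complex.ofReal_eq_zero]
          positivity
      exact hseq.frequently (.of_forall fun n => hreal _)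
    have h3 := congrFun heq (Complex.I * β)
    rw [h3, hkφ, ← mul_assoc]
    have h4 : Complex.exp (-(k * (Complex.I * β) * Complex.I)) * ((Real.exp (-β) : ℝ) : ℂ) ^ k
        = 1 := by
      rw [Complex.ofReal_exp, ← Complex.exp_int_mul, ← Complex.exp_add]
      have : -(k * (Complex.I * β) * Complex.I) + k * ((-β : ℝ) : ℂ) = 0 := by
        push_cast
        linear_combination -(k * β : ℂ) * Complex.I_mul_I
      rw [this, Complex.exp_zero]
    rw [h4, one_mul]
  exact DFunLike.congr_fun key b

end CStar

end DirGraph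

end

/-! ### The main theorem -/

theorem theorem1 {V E : Type*} [Fintype V] [Fintype E] [Nonempty E] (G : DirGraph V E)
    (hG : G.IsStronglyConnected) :
    (∀ (β₁ β₂ : ℝ) (φ₁ φ₂ : G.CStar →L[ℂ] ℂ),
      IsKMSState (DirGraph.CStar.dynamics G) β₁ φ₁ → IsKMSState (DirGraph.CStar.dynamics G) β₂ φ₂ →
        φ₁ = φ₂) ∧
    0 < G.rho ∧
    (∀ (β : ℝ) (φ : G.CStar →L[ℂ] ℂ),
      IsKMSState (DirGraph.CStar.dynamics G) β φ → β = Real.log G.rho) ∧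
    (∃ φ : G.CStar →L[ℂ] ℂ, IsKMSState (DirGraph.CStar.dynamics G) (Real.log G.rho) φ) := by
  have : Nonempty V := ‹Nonempty E›.map G.rng
  obtain ⟨m, l, hm0, hm1, hm⟩ := hG.exists_eigenvector
  have hne : m ≠ 0 := by rintro rfl; simp at hm1
  have hl := hG.eigenvalue_pos hm hm0 hne
  have hrho : G.rho = l := DirGraph.rho_eq_of_eigenvector hl hm (hG.eigenvector_pos hm hm0 hne)
  have hexp : Real.exp (-Real.log l) = l⁻¹ := by rw [Real.exp_neg, Real.exp_log hl]
  refine ⟨fun _ _ _ _ => DirGraph.CStar.isKMSState_unique hG, hrho ▸ hl, fun β φ hφ => ?_, ?_⟩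
  · rw [← DirGraph.CStar.exp_eq_rho_of_isKMSState hG hφ, Real.log_exp]
  · obtain ⟨φ, hst, hT, h1⟩ := DirGraph.CStar.exists_state_fixed (c := l⁻¹) hG.surjective_rng hm0
      (by rwa [inv_inv]) (inv_pos.mpr hl) hm1
    exact ⟨φ, DirGraph.CStar.isKMSState_of_fixed hst (by rwa [hrho, hexp]) h1⟩
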